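/- Let $m<n$, let $x_1,\dots,x_N\in\mathbb R^n$ span an $m$-dimensional subspace $L$, and for a noise array $\epsilon=(\epsilon_1,\dots,\epsilon_N)\in(\mathbb R^n)^N$ put $x_k'=x_k+\epsilon_k$, $X'=(x_1',\dots,x_N')$, $C_\epsilon=\sum_k x_k x_k'^T$ and $C'_\epsilon=\sum_k x_k'x_k'^T$. The standard linear autoencoder is the problem $$\min_{A',Q'\in\mathbb R^{n\times m}}\ \sum_{k=1}^N\|A'Q'^Tx_k'-x_k'\|^2\quad\text{s.t. } Q'^TQ'=I_m \text{ and the columns of } Q' \text{ lie in the column space of } X'.$$ For $Q_1,Q_2\in\mathbb R^{n\times m}$ with orthonormal columns let $\mathcal D(Q_1,Q_2)=Q_1-Q_2R^\star$, where $R^\star\in\operatorname{argmin}_{R\in O(m)}\|Q_1-Q_2R\|_{\mathcal F}^2$. Let the columns of $Q\in\mathbb R^{n\times m}$ be orthonormal eigenvectors of $C=C_0=\sum_k x_kx_k^T$ for its $m$ largest eigenvalues (with multiplicity) $\lambda_1,\dots,\lambda_m$, and let $\Lambda=\operatorname{diag}(\lambda_1,\dots,\lambda_m)$. Then: 1. If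 $\epsilon_k\in L^\perp$ for all $k$, then the columns of $Q$ are also orthonormal eigenvectors of $C_\epsilon$ for its $m$ largest eigenvalues $\lambda_1,\dots,\lambda_m$, and the standard autoencoder problem has a solution. 2. For every $\epsilon$ with $\operatorname{rank}X'\ge m$, a pair $(A',Q')$ solves the problem if and only if $A'=Q'$ and $Q'=UR$, where the columns of $U$ are orthonormal eigenvectors of $C'_\epsilon$ for its $m$ largest eigenvalues and $R\in O(m)$. 3. There is a choice $\epsilon\mapsto\hat Q^\star(\epsilon)$ of optimal encoders for all $\epsilon$ near $0$ that is continuous at $0$ with $\hat Q^\star(0)=Q$. For every such choice, $\epsilon\mapsto\mathcal D(\hat Q^\star(\epsilon),Q)$ is Fréchet differentiable at $\epsilon=0$, with partial derivatives $$\left.\frac{\partial\mathcal D(\hat Q^\star,Q)}{\partial\epsilon_{ki}}\right|_{\epsilon=0}=(I_n-QQ^T)(e_ix_k^T)Q\Lambda^{+}\qquad(1\le k\le N,\ 1\le i\le n),$$ where $\epsilon_{ki}$ is the $i$-th coordinate of $\epsilon_k$ and $e_i$ is the $i$-th standard basis vector. For an arbitrary choice of optimal encoders near $0$ the same holds for $\mathcal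 D(\hat Q^\star(\epsilon),Q)\,R^\star(\epsilon)^T=\hat Q^\star(\epsilon)R^\star(\epsilon)^T-Q$ in place of $\mathcal D(\hat Q^\star(\epsilon),Q)$, where $R^\star(\epsilon)$ is the rotation in $\mathcal D(\hat Q^\star(\epsilon),Q)$. Both statements also hold when $\epsilon$ is restricted to any set of noise arrays that contains $0$, in particular to $(L^\perp)^N$ (then the derivative at $0$ relative to that set is the restriction of the same linear map). 4. The standard encoder is sensitive to sampling variations: for every $k$ with $x_k\ne0$ there is an $i$ for which the matrix $(I_n-QQ^T)(e_ix_k^T)Q\Lambda^{+}$ is nonzero. -/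

import Mathlib

open Filter Topology
open scoped Matrix

namespace LinearAE

/-- `ℝⁿ` with the Euclidean norm. -/
abbrev Vec (n : ℕ) := EuclideanSpace ℝ (Fin n)

/-- The covariance matrix `∑ₖ xₖ yₖᵀ` of two data sets. -/
def covMatrix {n N : ℕ} (x y : Fin N → Vec n) : Matrix (Fin n) (Fin n) ℝ :=
  ∑ k, Matrix.vecMulVec (x k) (y k)

/-- The columns of `Q` are orthonormal eigenvectors of `C` with eigenvalues `lam 0, …, lam (m-1)`,
and these are the `m` largest eigenvalues of `C`, counted with (algebraic) multiplicity:
the remaining real roots `s` of the characteristic polynomial do not exceed any of them. -/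
def IsTopEigenvectors {n m : ℕ} (C : Matrix (Fin n) (Fin n) ℝ)
    (Q : Matrix (Fin n) (Fin m) ℝ) (lam : Fin m → ℝ) : Prop :=
  Qᵀ * Q = 1 ∧ C * Q = Q * Matrix.diagonal lam ∧
    ∃ s : Multiset ℝ, C.charpoly.roots = Finset.univ.val.map lam + s ∧
      ∀ μ ∈ s, ∀ j, μ ≤ lam j

/-- The reconstruction loss `∑ₖ ‖A Qᵀ yₖ - yₖ‖²` of the standard linear autoencoder with
encoder `Q` and decoder `A` on the data `y`. -/
noncomputable def loss {n m N : ℕ} (y : Fin N → Vec n) (A Q : Matrix (Fin n) (Fin m) ℝ) : ℝ :=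
  ∑ k, ‖WithLp.toLp 2 ((A * Qᵀ) *ᵥ (y k)) - y k‖ ^ 2

/-- The constraints on the encoder: `Qᵀ Q = I`, and the columns of `Q` lie in the column space of
the data matrix, that is, in the span of the data points. -/
def IsFeasible {n m N : ℕ} (y : Fin N → Vec n) (Q : Matrix (Fin n) (Fin m) ℝ) : Prop :=
  Qᵀ * Q = 1 ∧
    ∀ j, (WithLp.toLp 2 (fun i => Q i j) : Vec n) ∈ Submodule.span ℝ (Set.range y)

/-- `(A, Q)` is an optimal decoder-encoder pair of the standard linear autoencoder on `y`. -/
def IsOptimal {n m N : ℕ} (y : Fin N → Vec n) (A Q : Matrix (Fin n) (Fin m) ℝ) : Prop :=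
  IsFeasible y Q ∧
    ∀ A' Q' : Matrix (Fin n) (Fin m) ℝ, IsFeasible y Q' → loss y A Q ≤ loss y A' Q'

/-- `Q` is an optimal encoder of the standard linear autoencoder on `y`. -/
def IsOptimalEncoder {n m N : ℕ} (y : Fin N → Vec n) (Q : Matrix (Fin n) (Fin m) ℝ) : Prop :=
  ∃ A, IsOptimal y A Q

/-- The squared Frobenius norm. -/
def frobSq {n m : ℕ} (M : Matrix (Fin n) (Fin m) ℝ) : ℝ := ∑ i, ∑ j, M i j ^ 2

theorem isCompact_orthogonalGroup (m : ℕ) :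
    IsCompact (Matrix.orthogonalGroup (Fin m) ℝ : Set (Matrix (Fin m) (Fin m) ℝ)) := by
  have hb : IsCompact (Set.univ.pi fun _ : Fin m => Set.univ.pi fun _ : Fin m =>
      Set.Icc (-1 : ℝ) 1) :=
    isCompact_univ_pi fun _ => isCompact_univ_pi fun _ => isCompact_Icc
  refine hb.of_isClosed_subset
    (t := (Matrix.orthogonalGroup (Fin m) ℝ : Set (Matrix (Fin m) (Fin m) ℝ))) ?_ ?_
  · have : (Matrix.orthogonalGroup (Fin m) ℝ : Set (Matrix (Fin m) (Fin m) ℝ)) =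
        {R | R * Rᵀ = 1} := by
      ext R
      exact Matrix.mem_orthogonalGroup_iff (Fin m) ℝ
    rw [this]
    exact isClosed_eq (by fun_prop) continuous_const
  · intro R hR i _ j _
    have h := entry_norm_bound_of_unitary (𝕜 := ℝ) hR i j
    exact abs_le.mp h

theorem exists_procrustes {n m : ℕ} (Q₁ Q₂ : Matrix (Fin n) (Fin m) ℝ) :
    ∃ R ∈ Matrix.orthogonalGroup (Fin m) ℝ, ∀ R' ∈ Matrix.orthogonalGroup (Fin m) ℝ,
      frobSq (Q₁ - Q₂ * R) ≤ frobSq (Q₁ - Q₂ * R') := by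
  have hc : Continuous fun R : Matrix (Fin m) (Fin m) ℝ => frobSq (Q₁ - Q₂ * R) := by
    unfold frobSq
    refine continuous_finsetSum _ fun i _ => continuous_finsetSum _ fun j _ => ?_
    have h : Continuous fun R : Matrix (Fin m) (Fin m) ℝ => Q₁ - Q₂ * R := by fun_prop
    exact (h.matrix_elem i j).pow 2
  obtain ⟨R, hR, hmin⟩ := (isCompact_orthogonalGroup m).exists_isMinOn
    ⟨1, one_mem (Matrix.orthogonalGroup (Fin m) ℝ)⟩ hc.continuousOn
  exact ⟨R, hR, fun R' hR' => hmin hR'⟩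

/-- An optimal alignment `R⋆ ∈ argmin_{R ∈ O(m)} ‖Q₁ - Q₂ R‖²` (Frobenius norm). It is unique as
soon as `Q₂ᵀ Q₁` is invertible. -/
noncomputable def alignment {n m : ℕ} (Q₁ Q₂ : Matrix (Fin n) (Fin m) ℝ) :
    Matrix (Fin m) (Fin m) ℝ :=
  Classical.choose (exists_procrustes Q₁ Q₂)

/-- The deviation `D(Q₁, Q₂) = Q₁ - Q₂ R⋆`. -/
noncomputable def deviation {n m : ℕ} (Q₁ Q₂ : Matrix (Fin n) (Fin m) ℝ) :
    Matrix (Fin n) (Fin m) ℝ :=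
  Q₁ - Q₂ * alignment Q₁ Q₂

/-- The noise array with the single nonzero coordinate `ε_{ki} = 1`. -/
noncomputable def unitNoise {n N : ℕ} (k : Fin N) (i : Fin n) : Fin N → Vec n :=
  Pi.single k (EuclideanSpace.single i 1)

/-- The matrix `(I - Q Qᵀ) (eᵢ vᵀ) Q Λ⁺`, where `Λ = diag(lam)`; the pseudo-inverse of a diagonal
matrix is the diagonal matrix of the inverses, with `0⁻¹ = 0`. -/
noncomputable def sensitivity {n m : ℕ} (Q : Matrix (Fin n) (Fin m) ℝ) (lam : Fin m → ℝ)
    (v : Vec n) (i : Fin n) : Matrix (Fin n) (Fin m) ℝ :=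
  (1 - Q * Qᵀ) * Matrix.vecMulVec (Pi.single i 1) v * Q * Matrix.diagonal (fun j => (lam j)⁻¹)

end LinearAE

/-!
The argument rests on a certificate for being top eigenvectors: for symmetric `C`, orthonormal
eigenvectors `U` with eigenvalues `ν` are dominant iff for some `c ≤ min ν` the matrix
`c - C + U diag(ν - c) Uᵀ` is positive semidefinite (`isTopEigenvectors_iff`). It yields Ky Fan's
inequality `tr (Wᵀ C W) ≤ ∑ ν` for orthonormal `W` with an explicit gap (`IsDominant.trace_gap`),
and shows that in the case of equality `W` is a rotation of dominant eigenvectors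
(`IsDominant.exists_rotation`).

Optimal pairs: if the column space of a decoder `A` lies in that of an orthonormal `G`, then by
Pythagoras the loss of `(A, Q)` is `‖Y (Q Aᵀ - G Gᵀ)‖² + tr C' - tr (Gᵀ C' G)`, with `Y` the data
matrix and `C' = Yᵀ Y`. So the loss is at least `tr C' - ∑ ν`, and equality forces `G` to span a
dominant eigenspace and `Q Aᵀ` to agree with `G Gᵀ` on the data. As the columns of `Q` lie in the
span of the data, this gives `A = Q = G T` with `T` orthogonal (`isOptimal_iff`).

Derivative: the alignment `R⋆` makes `H = Qᵀ V R⋆ᵀ` symmetric positive semidefinite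
(`posSemidef_aligned`), and the aligned encoder `F = V R⋆ᵀ` tends to `Q`, by the gap in Ky Fan's
inequality (`tendsto_aligned_principalFrame`). With `P = 1 - Q Qᵀ`, the invariance
`C' F = F (Fᵀ C' F)` becomes `P F = P Eᵀ Y F (Fᵀ C' F)⁻¹`, where `E` is the noise matrix, because
`P` annihilates the clean data. The factor `P Eᵀ` is linear in the noise and the rest is continuous
at zero noise, which yields the derivative of `P F`; the component along `Q` contributes nothing,
since `H² - 1 = -(P F)ᵀ (P F)` is of second order (`isLittleO_aligned_principalFrame`).
-/

namespace LinearAE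

/-! ### Orthogonal splittings and dominant eigenvectors -/

/-- An orthonormal frame `G` whose span contains the columns of `A`, together with an orthonormal
frame `B` of the orthogonal complement of `G`; it comes from Gram–Schmidt applied to the columns of
`A` padded with zeros. -/
theorem exists_orthonormal_splitting {m k : ℕ} (A : Matrix (Fin (m + k)) (Fin m) ℝ) :
    ∃ (G : Matrix (Fin (m + k)) (Fin m) ℝ) (B : Matrix (Fin (m + k)) (Fin k) ℝ),
      Gᵀ * G = 1 ∧ Bᵀ * B = 1 ∧ Gᵀ * B = 0 ∧ G * Gᵀ + B * Bᵀ = 1 ∧ Bᵀ * A = 0 := by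
  let f : Fin (m + k) → Vec (m + k) :=
    Fin.addCases (fun j => WithLp.toLp 2 fun i => A i j) (fun _ => 0)
  let b := InnerProductSpace.gramSchmidtOrthonormalBasis (𝕜 := ℝ) (by simp) f
  have hb (p q) : ∑ i, b p i * b q i = if p = q then 1 else 0 := by
    rw [← orthonormal_iff_ite.mp b.orthonormal p q]
    simp [PiLp.inner_apply, mul_comm]
  let W : Matrix (Fin (m + k)) (Fin (m + k)) ℝ := Matrix.of fun i p => b p i
  have hW : Wᵀ * W = 1 := by
    ext p q
    simp [W, Matrix.mul_apply, hb, Matrix.one_apply]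
  have hW' : W * Wᵀ = 1 := mul_eq_one_comm.mp hW
  refine ⟨Matrix.of fun i p => b (Fin.castAdd k p) i, Matrix.of fun i p => b (Fin.natAdd m p) i,
    ?_, ?_, ?_, ?_, ?_⟩
  · ext p q
    simp [Matrix.mul_apply, hb, Matrix.one_apply]
  · ext p q
    simp [Matrix.mul_apply, hb, Matrix.one_apply]
  · ext p q
    simp only [Matrix.mul_apply, Matrix.transpose_apply, Matrix.of_apply, hb, Matrix.zero_apply]
    rw [if_neg]
    intro h
    have := congrArg Fin.val h
    simp at this
    omega
  · rw [← hW']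
    ext i j
    simp [W, Matrix.mul_apply, Fin.sum_univ_add]
  · ext p q
    have h := InnerProductSpace.gramSchmidtOrthonormalBasis_inv_triangular (𝕜 := ℝ)
      (show Module.finrank ℝ (Vec (m + k)) = Fintype.card (Fin (m + k)) by simp) f
      (i := Fin.castAdd k q) (j := Fin.natAdd m p) (by
        rw [Fin.lt_def]; simp; omega)
    simpa [Matrix.mul_apply, PiLp.inner_apply, f, b, mul_comm] using h

/-- Completion of an orthonormal frame to an orthonormal basis. -/
theorem splitting_of_orthonormal {m k : ℕ} (U : Matrix (Fin (m + k)) (Fin m) ℝ)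
    (hU : Uᵀ * U = 1) :
    ∃ B : Matrix (Fin (m + k)) (Fin k) ℝ,
      Bᵀ * B = 1 ∧ Uᵀ * B = 0 ∧ Bᵀ * U = 0 ∧ U * Uᵀ + B * Bᵀ = 1 := by
  obtain ⟨G, B, hG, hB, hGB, h1, hBU⟩ := exists_orthonormal_splitting U
  have hUB : Uᵀ * B = 0 := by
    have := congrArg Matrix.transpose hBU
    simpa using this
  refine ⟨B, hB, hUB, hBU, ?_⟩
  have hUG : U = G * (Gᵀ * U) := by
    calc U = (G * Gᵀ + B * Bᵀ) * U := by rw [h1, Matrix.one_mul]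
      _ = G * (Gᵀ * U) := by rw [Matrix.add_mul, Matrix.mul_assoc, Matrix.mul_assoc, hBU]; simp
  have hT : (Gᵀ * U)ᵀ * (Gᵀ * U) = 1 := by
    rw [Matrix.transpose_mul, Matrix.transpose_transpose, Matrix.mul_assoc, ← hUG, hU]
  have hT' : (Gᵀ * U) * (Gᵀ * U)ᵀ = 1 := mul_eq_one_comm.mp hT
  have hUU : U * Uᵀ = G * Gᵀ := by
    calc U * Uᵀ = (G * (Gᵀ * U)) * (G * (Gᵀ * U))ᵀ := by rw [← hUG]
      _ = G * ((Gᵀ * U) * (Gᵀ * U)ᵀ) * Gᵀ := by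
        rw [Matrix.transpose_mul G]; simp only [Matrix.mul_assoc]
      _ = G * Gᵀ := by rw [hT', Matrix.mul_one]
  rw [hUU, h1]

/-- In an orthonormal basis adapted to an invariant subspace, `C` is block triangular, so its
characteristic polynomial is the product of those of the diagonal blocks. -/
theorem charpoly_of_invariant {m k : ℕ} (C : Matrix (Fin (m + k)) (Fin (m + k)) ℝ)
    {U : Matrix (Fin (m + k)) (Fin m) ℝ} {B : Matrix (Fin (m + k)) (Fin k) ℝ}
    (hU : Uᵀ * U = 1) (hBU : Bᵀ * U = 0)
    (h1 : U * Uᵀ + B * Bᵀ = 1) {D : Matrix (Fin m) (Fin m) ℝ} (hC : C * U = U * D) :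
    C.charpoly = D.charpoly * (Bᵀ * C * B).charpoly := by
  let O := Matrix.fromCols U B
  have hO : Oᵀ = Matrix.fromRows Uᵀ Bᵀ := Matrix.transpose_fromCols U B
  have hOO : O * Oᵀ = 1 := by
    rw [hO, Matrix.fromCols_mul_fromRows, h1]
  have hOCO : Oᵀ * C * O = Matrix.fromBlocks D (Uᵀ * C * B) 0 (Bᵀ * C * B) := by
    rw [hO, Matrix.fromRows_mul, Matrix.fromRows_mul_fromCols]
    congr 1
    · rw [Matrix.mul_assoc, hC, ← Matrix.mul_assoc, hU, Matrix.one_mul]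
    · rw [Matrix.mul_assoc, hC, ← Matrix.mul_assoc, hBU, Matrix.zero_mul]
  have h := Matrix.charpoly_mul_comm_of_le (O) (Oᵀ * C) (by simp)
  rw [← Matrix.mul_assoc, hOO, Matrix.one_mul, hOCO, Matrix.charpoly_fromBlocks_zero₂₁] at h
  simpa using h

theorem posSemidef_smul_one_sub_iff {k : ℕ} {A : Matrix (Fin k) (Fin k) ℝ} (hA : A.IsHermitian)
    (c : ℝ) : (c • 1 - A).PosSemidef ↔ ∀ μ ∈ A.charpoly.roots, μ ≤ c := by
  rw [hA.roots_charpoly_eq_eigenvalues]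
  constructor
  · intro h μ hμ
    obtain ⟨i, -, rfl⟩ := Multiset.mem_map.mp hμ
    have h1 := h.dotProduct_mulVec_nonneg (hA.eigenvectorBasis i).ofLp
    have h2 := hA.eigenvalues_eq i
    have h3 : star (hA.eigenvectorBasis i).ofLp ⬝ᵥ (hA.eigenvectorBasis i).ofLp = 1 := by
      have := hA.eigenvectorBasis.orthonormal.1 i
      have h4 := EuclideanSpace.inner_eq_star_dotProduct (hA.eigenvectorBasis i)
        (hA.eigenvectorBasis i)
      rw [real_inner_self_eq_norm_sq, this] at h4
      rw [dotProduct_comm]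
      simpa using h4.symm
    rw [Matrix.sub_mulVec, dotProduct_sub, Matrix.smul_mulVec, Matrix.one_mulVec,
      dotProduct_smul, h3] at h1
    simp only [Function.comp_apply, h2]
    simpa using h1
  · intro h
    have h' (i) : hA.eigenvalues i ≤ c := h _ (Multiset.mem_map.mpr ⟨i, by simp, rfl⟩)
    have hV : (hA.eigenvectorUnitary : Matrix (Fin k) (Fin k) ℝ) *
        (hA.eigenvectorUnitary : Matrix (Fin k) (Fin k) ℝ)ᴴ = 1 :=
      Unitary.mul_star_self_of_mem hA.eigenvectorUnitary.2
    have hs := hA.spectral_theorem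
    rw [Unitary.conjStarAlgAut_apply] at hs
    have key : c • 1 - A = (hA.eigenvectorUnitary : Matrix (Fin k) (Fin k) ℝ) *
        Matrix.diagonal (fun i => c - hA.eigenvalues i) *
        (hA.eigenvectorUnitary : Matrix (Fin k) (Fin k) ℝ)ᴴ := by
      have : Matrix.diagonal (fun i => c - hA.eigenvalues i) =
          c • (1 : Matrix (Fin k) (Fin k) ℝ) - Matrix.diagonal hA.eigenvalues := by
        rw [← Matrix.diagonal_one, ← Matrix.diagonal_smul, Matrix.diagonal_sub]
        congr 1; ext i; simp
      rw [this, Matrix.mul_sub, Matrix.sub_mul, Matrix.mul_smul, Matrix.mul_one, Matrix.smul_mul,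
        hV]
      congr 1
    rw [key]
    exact (Matrix.PosSemidef.diagonal fun i => sub_nonneg.mpr (h' i)).mul_mul_conjTranspose_same _

/-- A certificate that the columns of `U` are orthonormal eigenvectors of `C` for its largest
eigenvalues `ν`: the number `c` separates `ν` from the rest of the spectrum, and the last field says
that `C ≤ c` on the orthogonal complement of `U` (on `U` itself the matrix vanishes). -/
structure IsDominant {n m : ℕ} (C : Matrix (Fin n) (Fin n) ℝ) (U : Matrix (Fin n) (Fin m) ℝ)
    (ν : Fin m → ℝ) (c : ℝ) : Prop where
  orthonormal : Uᵀ * U = 1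
  eigen : C * U = U * Matrix.diagonal ν
  le : ∀ j, c ≤ ν j
  posSemidef : (c • 1 - C + U * Matrix.diagonal (fun j => ν j - c) * Uᵀ).PosSemidef

theorem diagonal_sub_const {m : ℕ} (ν : Fin m → ℝ) (c : ℝ) :
    Matrix.diagonal (fun j => ν j - c) = Matrix.diagonal ν - c • (1 : Matrix (Fin m) (Fin m) ℝ) := by
  rw [← Matrix.diagonal_one, ← Matrix.diagonal_smul, Matrix.diagonal_sub]
  congr 1; ext i; simp

theorem isTopEigenvectors_iff {n m : ℕ} (hmn : m ≤ n) {C : Matrix (Fin n) (Fin n) ℝ}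
    (hC : Cᵀ = C) (U : Matrix (Fin n) (Fin m) ℝ) (ν : Fin m → ℝ) :
    IsTopEigenvectors C U ν ↔ ∃ c, IsDominant C U ν c := by
  obtain ⟨k, rfl⟩ := Nat.exists_eq_add_of_le hmn
  have main (hU : Uᵀ * U = 1) (hCU : C * U = U * Matrix.diagonal ν) :
      ∃ s : Multiset ℝ, C.charpoly.roots = Finset.univ.val.map ν + s ∧
      ∀ c, (c • 1 - C + U * Matrix.diagonal (fun j => ν j - c) * Uᵀ).PosSemidef ↔
        ∀ μ ∈ s, μ ≤ c := by
    obtain ⟨B, hB, hUB, hBU, h1⟩ := splitting_of_orthonormal U hU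
    have hUC : Uᵀ * C = Matrix.diagonal ν * Uᵀ := by
      have := congrArg Matrix.transpose hCU
      simpa [hC] using this
    refine ⟨(Bᵀ * C * B).charpoly.roots, ?_, fun c => ?_⟩
    · rw [charpoly_of_invariant C hU hBU h1 hCU, Polynomial.roots_mul,
        Matrix.charpoly_diagonal, Polynomial.roots_prod]
      · simp
      · simp [Finset.prod_ne_zero_iff, Polynomial.X_sub_C_ne_zero]
      · exact mul_ne_zero (Matrix.charpoly_monic _).ne_zero (Matrix.charpoly_monic _).ne_zero
    · have hH : (Bᵀ * C * B).IsHermitian := by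
        rw [Matrix.IsHermitian, Matrix.conjTranspose_eq_transpose_of_trivial]
        simp [hC, Matrix.mul_assoc]
      rw [← posSemidef_smul_one_sub_iff hH c]
      have hBSB : Bᵀ * (c • 1 - C + U * Matrix.diagonal (fun j => ν j - c) * Uᵀ) * B =
          c • 1 - Bᵀ * C * B := by
        rw [Matrix.mul_add, Matrix.add_mul, Matrix.mul_assoc U, ← Matrix.mul_assoc Bᵀ U, hBU,
          Matrix.zero_mul, Matrix.zero_mul, add_zero, Matrix.mul_sub, Matrix.sub_mul,
          Matrix.mul_smul, Matrix.mul_one, Matrix.smul_mul, hB]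
      have hS : c • 1 - C + U * Matrix.diagonal (fun j => ν j - c) * Uᵀ =
          B * (c • 1 - Bᵀ * C * B) * Bᵀ := by
        have e1 : C = U * Matrix.diagonal ν * Uᵀ + B * Bᵀ * C * (B * Bᵀ) := by
          have hBB : B * Bᵀ = 1 - U * Uᵀ := by rw [← h1]; abel
          have : (1 - U * Uᵀ) * C = C - U * Matrix.diagonal ν * Uᵀ := by
            rw [Matrix.sub_mul, Matrix.one_mul, Matrix.mul_assoc, hUC, Matrix.mul_assoc]
          rw [hBB, this, Matrix.mul_sub, Matrix.mul_one, Matrix.sub_mul, ← Matrix.mul_assoc C, hCU,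
            Matrix.mul_assoc (U * _) Uᵀ, ← Matrix.mul_assoc Uᵀ U, hU, Matrix.one_mul]
          abel
        rw [diagonal_sub_const, Matrix.mul_sub, Matrix.sub_mul, Matrix.mul_sub, Matrix.sub_mul]
        conv_lhs => rw [e1, ← h1]
        simp only [Matrix.mul_smul, Matrix.smul_mul, Matrix.mul_one, Matrix.mul_assoc, smul_add]
        abel
      constructor
      · intro h
        have := h.conjTranspose_mul_mul_same B
        rwa [Matrix.conjTranspose_eq_transpose_of_trivial, hBSB] at this
      · intro h
        have := h.mul_mul_conjTranspose_same B
        rwa [Matrix.conjTranspose_eq_transpose_of_trivial, ← hS] at this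
  constructor
  · rintro ⟨hU, hCU, s, hs, hle⟩
    obtain ⟨s', hs', hS⟩ := main hU hCU
    obtain rfl : s = s' := add_left_cancel (hs.symm.trans hs')
    obtain ⟨c, hc, hc'⟩ : ∃ c, (∀ j, c ≤ ν j) ∧ ∀ μ ∈ s, μ ≤ c := by
      rcases isEmpty_or_nonempty (Fin m) with h | h
      · obtain ⟨c, hc⟩ := s.toFinset.exists_le
        exact ⟨c, fun j => h.elim j, fun μ hμ => hc μ (by simpa using hμ)⟩
      · obtain ⟨j, hj⟩ := Finite.exists_min ν
        exact ⟨ν j, hj, fun μ hμ => hle μ hμ j⟩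
    exact ⟨c, hU, hCU, hc, (hS c).mpr hc'⟩
  · rintro ⟨c, hU, hCU, hc, hP⟩
    obtain ⟨s, hs, hS⟩ := main hU hCU
    exact ⟨hU, hCU, s, hs, fun μ hμ j => ((hS c).mp hP μ hμ).trans (hc j)⟩

theorem exists_orthogonal_diagonalization {k : ℕ} {M : Matrix (Fin k) (Fin k) ℝ} (hM : Mᵀ = M) :
    ∃ R ∈ Matrix.orthogonalGroup (Fin k) ℝ, ∃ δ : Fin k → ℝ,
      M = R * Matrix.diagonal δ * Rᵀ ∧ M.charpoly.roots = Finset.univ.val.map δ := by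
  have hH : M.IsHermitian := by
    rw [Matrix.IsHermitian, Matrix.conjTranspose_eq_transpose_of_trivial, hM]
  refine ⟨_, hH.eigenvectorUnitary.2, hH.eigenvalues, ?_, ?_⟩
  · have hs := hH.spectral_theorem
    rwa [Unitary.conjStarAlgAut_apply] at hs
  · exact hH.roots_charpoly_eq_eigenvalues

theorem exists_isTopEigenvectors {n m : ℕ} (hmn : m ≤ n) {C : Matrix (Fin n) (Fin n) ℝ}
    (hC : Cᵀ = C) : ∃ (U : Matrix (Fin n) (Fin m) ℝ) (ν : Fin m → ℝ),
      IsTopEigenvectors C U ν := by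
  obtain ⟨R, hR, δ, hCR, hroots⟩ := exists_orthogonal_diagonalization hC
  have hRR : Rᵀ * R = 1 := (Matrix.mem_orthogonalGroup_iff' (Fin n) ℝ).mp hR
  let σ := Tuple.sort δ
  have hσ : Monotone (δ ∘ σ) := Tuple.monotone_sort δ
  obtain ⟨k, rfl⟩ := Nat.exists_eq_add_of_le hmn
  let e : Fin m → Fin (m + k) := fun j => σ (Fin.rev (Fin.castAdd k j))
  let e' : Fin k → Fin (m + k) := fun j => σ (Fin.rev (Fin.natAdd m j))
  have he : Function.Injective e := fun a b h => by simpa [e] using h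
  refine ⟨R.submatrix id e, δ ∘ e, ?_, ?_, Finset.univ.val.map (δ ∘ e'), ?_, ?_⟩
  · have : (R.submatrix id e)ᵀ * R.submatrix id e = (Rᵀ * R).submatrix e e :=
      (Matrix.submatrix_mul Rᵀ R e id e Function.bijective_id).symm
    rw [this, hRR, Matrix.submatrix_one e he]
  · have hCR' : C * R = R * Matrix.diagonal δ := by
      rw [hCR, Matrix.mul_assoc, hRR, Matrix.mul_one]
    ext i j
    have := congrFun (congrFun hCR' i) (e j)
    rw [Matrix.mul_diagonal] at this ⊢
    simpa [Matrix.mul_apply] using this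
  · rw [hroots]
    have h1 : Finset.univ.val.map δ =
        Finset.univ.val.map (fun j => δ (σ (Fin.rev (finSumFinEquiv j)))) := by
      have := Multiset.map_univ_val_equiv ((finSumFinEquiv.trans Fin.revPerm).trans σ)
      rw [← this, Multiset.map_map]
      rfl
    rw [h1]
    simp [e, e', Function.comp_def, ← Finset.univ_disjSum_univ, Finset.val_disjSum, Multiset.disjSum]
  · intro μ hμ j
    obtain ⟨i, -, rfl⟩ := Multiset.mem_map.mp hμ
    apply hσ
    rw [Fin.rev_le_rev, Fin.le_def]
    simp
    omega

/-! ### The trace inequality and its equality case -/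

theorem frobSq_eq_trace {n m : ℕ} (M : Matrix (Fin n) (Fin m) ℝ) : frobSq M = (M * Mᵀ).trace := by
  simp [frobSq, Matrix.trace, Matrix.mul_apply, pow_two]

theorem frobSq_eq_trace' {n m : ℕ} (M : Matrix (Fin n) (Fin m) ℝ) :
    frobSq M = (Mᵀ * M).trace := by
  rw [frobSq_eq_trace, Matrix.trace_mul_comm]

theorem frobSq_nonneg {n m : ℕ} (M : Matrix (Fin n) (Fin m) ℝ) : 0 ≤ frobSq M :=
  Finset.sum_nonneg fun _ _ => Finset.sum_nonneg fun _ _ => sq_nonneg _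

theorem sq_le_frobSq {n m : ℕ} (M : Matrix (Fin n) (Fin m) ℝ) (i : Fin n) (j : Fin m) :
    M i j ^ 2 ≤ frobSq M :=
  (Finset.single_le_sum (f := fun j => M i j ^ 2) (fun _ _ => sq_nonneg _)
    (Finset.mem_univ j)).trans
    (Finset.single_le_sum (f := fun i => ∑ j, M i j ^ 2)
      (fun _ _ => Finset.sum_nonneg fun _ _ => sq_nonneg _) (Finset.mem_univ i))

theorem frobSq_eq_zero {n m : ℕ} {M : Matrix (Fin n) (Fin m) ℝ} (h : frobSq M = 0) : M = 0 := by
  ext i j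
  have := sq_le_frobSq M i j
  rw [h] at this
  exact pow_eq_zero_iff two_ne_zero |>.mp (le_antisymm this (sq_nonneg _))

theorem IsDominant.trace_eq {n m : ℕ} {C : Matrix (Fin n) (Fin n) ℝ}
    {U : Matrix (Fin n) (Fin m) ℝ} {ν : Fin m → ℝ} {c : ℝ} (h : IsDominant C U ν c) :
    (Uᵀ * C * U).trace = ∑ j, ν j := by
  rw [Matrix.mul_assoc, h.eigen, ← Matrix.mul_assoc, h.orthonormal, Matrix.one_mul,
    Matrix.trace_diagonal]

/-- The Gram matrix of the part of `U` orthogonal to the frame `W`. -/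
theorem projection_residual_gram {n m p : ℕ} {W : Matrix (Fin n) (Fin m) ℝ} (hW : Wᵀ * W = 1)
    (U : Matrix (Fin n) (Fin p) ℝ) :
    (U - W * (Wᵀ * U))ᵀ * (U - W * (Wᵀ * U)) = Uᵀ * U - Uᵀ * W * (Wᵀ * U) := by
  have h : Wᵀ * (U - W * (Wᵀ * U)) = 0 := by
    rw [Matrix.mul_sub, ← Matrix.mul_assoc Wᵀ W, hW, Matrix.one_mul, sub_self]
  rw [Matrix.transpose_sub, Matrix.sub_mul, Matrix.transpose_mul W, Matrix.mul_assoc (Wᵀ * U)ᵀ, h,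
    Matrix.mul_zero, sub_zero, Matrix.mul_sub]
  simp only [Matrix.mul_assoc]

/-- The amount by which an orthonormal frame `W` misses the largest possible trace, as a sum of two
terms that are nonnegative for a dominant `U`. -/
theorem IsDominant.trace_gap {n m : ℕ} {C : Matrix (Fin n) (Fin n) ℝ}
    {U : Matrix (Fin n) (Fin m) ℝ} {ν : Fin m → ℝ} {c : ℝ} (h : IsDominant C U ν c)
    {W : Matrix (Fin n) (Fin m) ℝ} (hW : Wᵀ * W = 1) :
    ∑ j, ν j - (Wᵀ * C * W).trace =
      (Wᵀ * (c • 1 - C + U * Matrix.diagonal (fun j => ν j - c) * Uᵀ) * W).trace +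
      ∑ j, (ν j - c) * ∑ i, (U - W * (Wᵀ * U)) i j ^ 2 := by
  have h1 : ∑ j, (ν j - c) * ∑ i, (U - W * (Wᵀ * U)) i j ^ 2 =
      (Matrix.diagonal (fun j => ν j - c) *
        ((U - W * (Wᵀ * U))ᵀ * (U - W * (Wᵀ * U)))).trace := by
    simp only [Matrix.trace, Matrix.diag_apply, Matrix.diagonal_mul]
    simp only [Matrix.mul_apply (M := (U - W * (Wᵀ * U))ᵀ), Matrix.transpose_apply, pow_two]
  have h2 : (Wᵀ * (U * Matrix.diagonal (fun j => ν j - c) * Uᵀ) * W).trace =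
      (Matrix.diagonal (fun j => ν j - c) * (Uᵀ * W * (Wᵀ * U))).trace := by
    rw [show Wᵀ * (U * Matrix.diagonal (fun j => ν j - c) * Uᵀ) * W =
      (Wᵀ * U) * (Matrix.diagonal (fun j => ν j - c) * (Uᵀ * W)) by simp only [Matrix.mul_assoc],
      Matrix.trace_mul_comm, Matrix.mul_assoc]
  rw [h1, projection_residual_gram hW, Matrix.mul_add, Matrix.add_mul, Matrix.trace_add, h2,
    Matrix.mul_sub (Matrix.diagonal _), Matrix.trace_sub, h.orthonormal, Matrix.mul_one,
    Matrix.trace_diagonal, Matrix.mul_sub, Matrix.sub_mul, Matrix.trace_sub, Matrix.mul_smul,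
    Matrix.mul_one, Matrix.smul_mul, hW, Matrix.trace_smul, Matrix.trace_one,
    Finset.sum_sub_distrib]
  simp
  ring

/-- Ky Fan's inequality. -/
theorem IsDominant.trace_le {n m : ℕ} {C : Matrix (Fin n) (Fin n) ℝ}
    {U : Matrix (Fin n) (Fin m) ℝ} {ν : Fin m → ℝ} {c : ℝ} (h : IsDominant C U ν c)
    {W : Matrix (Fin n) (Fin m) ℝ} (hW : Wᵀ * W = 1) :
    (Wᵀ * C * W).trace ≤ ∑ j, ν j := by
  have h1 := h.trace_gap hW
  have h2 := (h.posSemidef.conjTranspose_mul_mul_same W).trace_nonneg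
  rw [Matrix.conjTranspose_eq_transpose_of_trivial] at h2
  have h3 : 0 ≤ ∑ j, (ν j - c) * ∑ i, (U - W * (Wᵀ * U)) i j ^ 2 :=
    Finset.sum_nonneg fun j _ => mul_nonneg (sub_nonneg.mpr (h.le j))
      (Finset.sum_nonneg fun _ _ => sq_nonneg _)
  linarith

theorem mul_eq_zero_of_posSemidef {n m : ℕ} {S : Matrix (Fin n) (Fin n) ℝ} (hS : S.PosSemidef)
    {W : Matrix (Fin n) (Fin m) ℝ} (h : Wᵀ * S * W = 0) : S * W = 0 := by
  ext i j
  have h1 : star (fun i => W i j) ⬝ᵥ S *ᵥ (fun i => W i j) = 0 := by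
    have := congrFun (congrFun h j) j
    rw [Matrix.mul_assoc] at this
    simpa [Matrix.mul_apply, dotProduct, Matrix.mulVec] using this
  simpa [Matrix.mul_apply, dotProduct, Matrix.mulVec] using
    congrFun ((hS.dotProduct_mulVec_zero_iff _).mp h1) i

/-- The equality case of Ky Fan's inequality. Both terms of `IsDominant.trace_gap` vanish, which
makes the span of `W` invariant under `C`; diagonalising `C` on it gives the rotation `R`, and the
certificate matrix of `W R` is the same as that of `U`. -/
theorem IsDominant.exists_rotation {n m : ℕ} {C : Matrix (Fin n) (Fin n) ℝ}
    {U : Matrix (Fin n) (Fin m) ℝ} {ν : Fin m → ℝ} {c : ℝ} (h : IsDominant C U ν c)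
    {W : Matrix (Fin n) (Fin m) ℝ} (hW : Wᵀ * W = 1) (heq : (Wᵀ * C * W).trace = ∑ j, ν j) :
    ∃ R ∈ Matrix.orthogonalGroup (Fin m) ℝ, ∃ δ, IsDominant C (W * R) δ c := by
  set E := Matrix.diagonal (fun j => ν j - c) with hE
  have h1 := h.trace_gap hW
  have hps := h.posSemidef.conjTranspose_mul_mul_same W
  rw [Matrix.conjTranspose_eq_transpose_of_trivial] at hps
  have h2 := hps.trace_nonneg
  have h3 (j : Fin m) : 0 ≤ (ν j - c) * ∑ i, (U - W * (Wᵀ * U)) i j ^ 2 :=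
    mul_nonneg (sub_nonneg.mpr (h.le j)) (Finset.sum_nonneg fun _ _ => sq_nonneg _)
  have h3' := Finset.sum_nonneg fun j (_ : j ∈ Finset.univ) => h3 j
  have hS : (c • 1 - C + U * E * Uᵀ) * W = 0 := by
    have h4 : Wᵀ * (c • 1 - C + U * E * Uᵀ) * W = 0 := hps.trace_eq_zero_iff.mp (by linarith)
    exact mul_eq_zero_of_posSemidef h.posSemidef h4
  have hUE : W * (Wᵀ * U) * E = U * E := by
    have h5 : ∑ j, (ν j - c) * ∑ i, (U - W * (Wᵀ * U)) i j ^ 2 = 0 := by linarith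
    rw [Finset.sum_eq_zero_iff_of_nonneg fun j _ => h3 j] at h5
    ext i j
    rw [hE, Matrix.mul_diagonal, Matrix.mul_diagonal]
    rcases mul_eq_zero.mp (h5 j (Finset.mem_univ j)) with h6 | h6
    · simp [h6]
    · rw [Finset.sum_eq_zero_iff_of_nonneg fun i _ => sq_nonneg _] at h6
      have := h6 i (Finset.mem_univ i)
      rw [pow_eq_zero_iff two_ne_zero, Matrix.sub_apply, sub_eq_zero] at this
      rw [this]
  have hEt : Eᵀ = E := Matrix.diagonal_transpose _
  have hEU : E * (Uᵀ * W * Wᵀ) = E * Uᵀ := by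
    have := congrArg Matrix.transpose hUE
    simpa [hEt, Matrix.mul_assoc] using this
  set M : Matrix (Fin m) (Fin m) ℝ := c • 1 + (Wᵀ * U) * E * (Uᵀ * W) with hM
  have hMt : Mᵀ = M := by
    simp [hM, hEt, Matrix.mul_assoc]
  have hCW : C * W = W * M := by
    have e1 : C * W = c • W + U * E * Uᵀ * W := by
      rw [Matrix.add_mul, Matrix.sub_mul, Matrix.smul_mul, Matrix.one_mul] at hS
      rw [← sub_eq_zero, ← neg_eq_zero, ← hS]; abel
    rw [e1, hM, Matrix.mul_add, Matrix.mul_smul, Matrix.mul_one]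
    congr 1
    rw [← hUE]; simp only [Matrix.mul_assoc]
  have hWMW : W * M * Wᵀ = c • (W * Wᵀ) + U * E * Uᵀ := by
    rw [hM, Matrix.mul_add, Matrix.add_mul, Matrix.mul_smul, Matrix.mul_one, Matrix.smul_mul]
    congr 1
    calc W * (Wᵀ * U * E * (Uᵀ * W)) * Wᵀ = W * (Wᵀ * U) * E * (Uᵀ * W * Wᵀ) := by
          simp only [Matrix.mul_assoc]
      _ = U * E * Uᵀ := by rw [hUE, Matrix.mul_assoc, hEU, Matrix.mul_assoc]
  obtain ⟨R, hR, δ, hMR, -⟩ := exists_orthogonal_diagonalization hMt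
  have hRR : Rᵀ * R = 1 := (Matrix.mem_orthogonalGroup_iff' (Fin m) ℝ).mp hR
  have hRR' : R * Rᵀ = 1 := (Matrix.mem_orthogonalGroup_iff (Fin m) ℝ).mp hR
  refine ⟨R, hR, δ, ?_, ?_, ?_, ?_⟩
  · rw [Matrix.transpose_mul, Matrix.mul_assoc, ← Matrix.mul_assoc Wᵀ, hW, Matrix.one_mul, hRR]
  · rw [← Matrix.mul_assoc, hCW, Matrix.mul_assoc, hMR, Matrix.mul_assoc, hRR, Matrix.mul_one,
      Matrix.mul_assoc]
  · intro j
    have e1 : Matrix.diagonal δ = Rᵀ * M * R := by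
      rw [hMR]
      simp only [← Matrix.mul_assoc, hRR, Matrix.one_mul]
      rw [Matrix.mul_assoc, hRR, Matrix.mul_one]
    have e2 : Matrix.diagonal δ - c • 1 = (Uᵀ * W * R)ᴴ * E * (Uᵀ * W * R) := by
      rw [e1, hM, Matrix.mul_add, Matrix.add_mul, Matrix.mul_smul, Matrix.mul_one, Matrix.smul_mul,
        hRR, Matrix.conjTranspose_eq_transpose_of_trivial]
      simp [Matrix.mul_assoc]
    have e3 : (Matrix.diagonal δ - c • 1).PosSemidef := by
      rw [e2]
      exact (Matrix.PosSemidef.diagonal fun i => sub_nonneg.mpr (h.le i)).conjTranspose_mul_mul_same _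
    have := e3.diag_nonneg (i := j)
    simpa using this
  · have : c • 1 - C + W * R * Matrix.diagonal (fun j => δ j - c) * (W * R)ᵀ =
        c • 1 - C + U * E * Uᵀ := by
      congr 1
      calc W * R * Matrix.diagonal (fun j => δ j - c) * (W * R)ᵀ
          = W * (R * Matrix.diagonal δ * Rᵀ) * Wᵀ - c • (W * (R * Rᵀ) * Wᵀ) := by
            rw [diagonal_sub_const, Matrix.mul_sub, Matrix.sub_mul, Matrix.transpose_mul]
            simp only [Matrix.mul_smul, Matrix.smul_mul, Matrix.mul_one, Matrix.mul_assoc]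
        _ = U * E * Uᵀ := by
            rw [← hMR, hWMW, hRR', Matrix.mul_one, add_sub_cancel_left]
    rw [this]
    exact h.posSemidef

/-! ### Optimal pairs of the autoencoder -/

/-- The data matrix, whose rows are the data points. -/
def dataMatrix {n N : ℕ} (y : Fin N → Vec n) : Matrix (Fin N) (Fin n) ℝ :=
  Matrix.of fun k i => y k i

theorem covMatrix_eq {n N : ℕ} (x y : Fin N → Vec n) :
    covMatrix x y = (dataMatrix x)ᵀ * dataMatrix y := by
  ext i j
  simp [covMatrix, dataMatrix, Matrix.mul_apply, Matrix.sum_apply, Matrix.vecMulVec_apply]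

theorem covMatrix_self_transpose {n N : ℕ} (y : Fin N → Vec n) :
    (covMatrix y y)ᵀ = covMatrix y y := by
  rw [covMatrix_eq, Matrix.transpose_mul, Matrix.transpose_transpose]

theorem loss_eq {n m N : ℕ} (y : Fin N → Vec n) (A Q : Matrix (Fin n) (Fin m) ℝ) :
    loss y A Q = frobSq (dataMatrix y * (Q * Aᵀ - 1)) := by
  unfold loss frobSq
  refine Finset.sum_congr rfl fun k _ => ?_
  rw [EuclideanSpace.norm_sq_eq]
  refine Finset.sum_congr rfl fun i _ => ?_
  have : (dataMatrix y * (Q * Aᵀ - (1 : Matrix (Fin n) (Fin n) ℝ)) :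
      Matrix (Fin N) (Fin n) ℝ) k i = ((A * Qᵀ) *ᵥ (y k)) i - y k i := by
    rw [Matrix.mul_sub, Matrix.mul_one, Matrix.sub_apply, ← Matrix.transpose_transpose Q,
      ← Matrix.transpose_mul, Matrix.mul_apply]
    simp [dataMatrix, Matrix.mulVec, dotProduct, mul_comm]
  rw [this]
  simp

theorem isFeasible_iff {n m N : ℕ} (y : Fin N → Vec n) (Q : Matrix (Fin n) (Fin m) ℝ) :
    IsFeasible y Q ↔ Qᵀ * Q = 1 ∧ ∃ B : Matrix (Fin N) (Fin m) ℝ, Q = (dataMatrix y)ᵀ * B := by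
  refine and_congr_right fun _ => ?_
  simp only [Submodule.mem_span_range_iff_exists_fun]
  constructor
  · intro h
    choose b hb using h
    refine ⟨Matrix.of fun k j => b j k, ?_⟩
    ext i j
    have := congrArg (fun v : Vec n => v i) (hb j)
    simpa [dataMatrix, Matrix.mul_apply, mul_comm] using this.symm
  · rintro ⟨B, rfl⟩ j
    refine ⟨fun k => B k j, ?_⟩
    ext i
    simp [dataMatrix, Matrix.mul_apply, mul_comm]

theorem finrank_span_eq_rank {n N : ℕ} (y : Fin N → Vec n) :
    Module.finrank ℝ (Submodule.span ℝ (Set.range y)) = (dataMatrix y).rank := by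
  rw [Matrix.rank_eq_finrank_span_row]
  have h : Submodule.span ℝ (Set.range (dataMatrix y).row) =
      (Submodule.span ℝ (Set.range y)).map (WithLp.linearEquiv 2 ℝ (Fin n → ℝ)).toLinearMap := by
    rw [Submodule.map_span, ← Set.range_comp]
    rfl
  rw [h]
  exact (LinearEquiv.finrank_map_eq (WithLp.linearEquiv 2 ℝ (Fin n → ℝ)) _).symm

/-- Pythagoras for the reconstruction: split the error into its parts along `G` and orthogonal to
`G`. -/
theorem loss_eq_add {n m N : ℕ} (y : Fin N → Vec n) {A G : Matrix (Fin n) (Fin m) ℝ}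
    (Q : Matrix (Fin n) (Fin m) ℝ) (hG : Gᵀ * G = 1) (hA : G * Gᵀ * A = A) :
    loss y A Q = frobSq (dataMatrix y * (Q * Aᵀ - G * Gᵀ)) +
      ((covMatrix y y).trace - (Gᵀ * covMatrix y y * G).trace) := by
  rw [loss_eq, covMatrix_eq]
  set Y := dataMatrix y
  have hA' : Aᵀ * (G * Gᵀ) = Aᵀ := by
    have := congrArg Matrix.transpose hA
    simpa [Matrix.mul_assoc] using this
  have hGG : G * Gᵀ * (G * Gᵀ) = G * Gᵀ := by
    rw [Matrix.mul_assoc, ← Matrix.mul_assoc Gᵀ, hG, Matrix.one_mul]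
  have hP : (Q * Aᵀ - G * Gᵀ) * (1 - G * Gᵀ) = 0 := by
    rw [Matrix.mul_sub, Matrix.mul_one, Matrix.sub_mul, Matrix.mul_assoc Q, hA', hGG, sub_self]
  have hsym : (1 - G * Gᵀ)ᵀ = 1 - G * Gᵀ := by simp
  have hidem : (1 - G * Gᵀ) * (1 - G * Gᵀ)ᵀ = 1 - G * Gᵀ := by
    rw [hsym, Matrix.mul_sub, Matrix.mul_one, Matrix.sub_mul, hGG, Matrix.one_mul, sub_self,
      sub_zero]
  have hcross : (Y * (Q * Aᵀ - G * Gᵀ)) * (Y * (1 - G * Gᵀ))ᵀ = 0 := by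
    rw [Matrix.transpose_mul, hsym, Matrix.mul_assoc, ← Matrix.mul_assoc _ (1 - G * Gᵀ), hP,
      Matrix.zero_mul, Matrix.mul_zero]
  have hsplit : Y * (Q * Aᵀ - 1) = Y * (Q * Aᵀ - G * Gᵀ) - Y * (1 - G * Gᵀ) := by
    rw [← Matrix.mul_sub]; congr 1; abel
  have hcross' : (Y * (1 - G * Gᵀ)) * (Y * (Q * Aᵀ - G * Gᵀ))ᵀ = 0 := by
    have := congrArg Matrix.transpose hcross
    rwa [Matrix.transpose_mul, Matrix.transpose_transpose, Matrix.transpose_zero] at this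
  have hR : frobSq (Y * (1 - G * Gᵀ)) = (Yᵀ * Y).trace - (Gᵀ * (Yᵀ * Y) * G).trace := by
    rw [frobSq_eq_trace, Matrix.transpose_mul, Matrix.mul_assoc, ← Matrix.mul_assoc _ _ Yᵀ, hidem,
      Matrix.sub_mul, Matrix.mul_sub, Matrix.one_mul, Matrix.trace_sub, Matrix.trace_mul_comm Y]
    congr 1
    rw [Matrix.trace_mul_comm, Matrix.mul_assoc (G * Gᵀ), Matrix.mul_assoc G,
      Matrix.trace_mul_comm]
  rw [← hR, hsplit, frobSq_eq_trace, Matrix.transpose_sub, Matrix.mul_sub, Matrix.sub_mul,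
    Matrix.sub_mul, hcross, hcross', zero_sub, sub_zero, sub_neg_eq_add, Matrix.trace_add,
    frobSq_eq_trace, frobSq_eq_trace]

/-- If some `ν j` were not positive, then `c ≤ 0` and the data matrix would factor through the other
`m - 1` eigenvectors. -/
theorem IsDominant.pos {n m N : ℕ} {y : Fin N → Vec n} (hr : m ≤ (dataMatrix y).rank)
    {U : Matrix (Fin n) (Fin m) ℝ} {ν : Fin m → ℝ} {c : ℝ}
    (h : IsDominant (covMatrix y y) U ν c) (j : Fin m) : 0 < ν j := by
  rw [covMatrix_eq] at h
  set Y := dataMatrix y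
  by_contra! hj
  have hYU : (Y * U)ᵀ * (Y * U) = Matrix.diagonal ν := by
    rw [Matrix.transpose_mul, Matrix.mul_assoc, ← Matrix.mul_assoc Yᵀ, h.eigen, ← Matrix.mul_assoc,
      h.orthonormal, Matrix.one_mul]
  have hcol (k : Fin N) : (Y * U) k j = 0 := by
    have h1 := congrFun (congrFun hYU j) j
    rw [Matrix.diagonal_apply_eq, Matrix.mul_apply] at h1
    simp only [Matrix.transpose_apply, ← pow_two] at h1
    have h2 : (Y * U) k j ^ 2 ≤ ∑ k, (Y * U) k j ^ 2 :=
      Finset.single_le_sum (f := fun k => (Y * U) k j ^ 2) (fun _ _ => sq_nonneg _)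
        (Finset.mem_univ k)
    exact pow_eq_zero_iff two_ne_zero |>.mp (le_antisymm (by linarith) (sq_nonneg _))
  have hc : c ≤ 0 := (h.le j).trans hj
  set P := 1 - U * Uᵀ with hP
  have hPt : Pᵀ = P := by simp [hP]
  have hUP : Uᵀ * P = 0 := by
    rw [hP, Matrix.mul_sub, Matrix.mul_one, ← Matrix.mul_assoc, h.orthonormal, Matrix.one_mul,
      sub_self]
  have hYP : Y * P = 0 := by
    apply frobSq_eq_zero
    apply le_antisymm _ (frobSq_nonneg _)
    have h1 := (h.posSemidef.conjTranspose_mul_mul_same P).trace_nonneg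
    have h2 : Pᴴ * (c • 1 - Yᵀ * Y + U * Matrix.diagonal (fun j => ν j - c) * Uᵀ) * P =
        c • (Pᵀ * P) - (Y * P)ᵀ * (Y * P) := by
      rw [Matrix.conjTranspose_eq_transpose_of_trivial, Matrix.mul_assoc, Matrix.add_mul,
        Matrix.mul_assoc (U * _), hUP, Matrix.mul_zero, add_zero, Matrix.sub_mul, Matrix.mul_sub,
        Matrix.smul_mul, Matrix.one_mul, Matrix.mul_smul, Matrix.transpose_mul]
      simp only [Matrix.mul_assoc]
    rw [h2, Matrix.trace_sub, Matrix.trace_smul, ← frobSq_eq_trace', ← frobSq_eq_trace',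
      smul_eq_mul] at h1
    nlinarith [frobSq_nonneg P]
  let d : Fin m → ℝ := fun i => if i = j then 0 else 1
  have hY : Y = Y * U * Matrix.diagonal d * Uᵀ := by
    have h1 : Y * U * Matrix.diagonal d = Y * U := by
      ext k i
      rw [Matrix.mul_diagonal]
      by_cases hi : i = j
      · rw [hi, hcol, zero_mul]
      · simp [d, hi]
    rw [h1, Matrix.mul_assoc]
    rw [hP, Matrix.mul_sub, Matrix.mul_one, sub_eq_zero] at hYP
    exact hYP
  have hlt : Y.rank < m := by
    calc Y.rank ≤ (Matrix.diagonal d).rank := by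
          rw [hY]
          exact (Matrix.rank_mul_le_left _ _).trans (Matrix.rank_mul_le_right _ _)
      _ = Fintype.card {i // d i ≠ 0} := Matrix.rank_diagonal d
      _ < Fintype.card (Fin m) := Fintype.card_subtype_lt (x := j) (by simp [d])
      _ = m := Fintype.card_fin m
  omega

theorem IsDominant.eq_transpose_mul {n m N : ℕ} {y : Fin N → Vec n}
    {U : Matrix (Fin n) (Fin m) ℝ} {ν : Fin m → ℝ} {c : ℝ}
    (h : IsDominant (covMatrix y y) U ν c) (hν : ∀ j, 0 < ν j) :
    U = (dataMatrix y)ᵀ * (dataMatrix y * U * Matrix.diagonal (fun j => (ν j)⁻¹)) := by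
  have h1 := h.eigen
  rw [covMatrix_eq] at h1
  rw [← Matrix.mul_assoc, ← Matrix.mul_assoc, h1, Matrix.mul_assoc, Matrix.diagonal_mul_diagonal]
  have : (fun j => ν j * (ν j)⁻¹) = fun _ => 1 := funext fun j => mul_inv_cancel₀ (hν j).ne'
  rw [this, Matrix.diagonal_one, Matrix.mul_one]

theorem IsDominant.isFeasible_mul {n m N : ℕ} {y : Fin N → Vec n}
    {U : Matrix (Fin n) (Fin m) ℝ} {ν : Fin m → ℝ} {c : ℝ}
    (h : IsDominant (covMatrix y y) U ν c) (hν : ∀ j, 0 < ν j) {R : Matrix (Fin m) (Fin m) ℝ}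
    (hR : R ∈ Matrix.orthogonalGroup (Fin m) ℝ) : IsFeasible y (U * R) := by
  rw [isFeasible_iff]
  have hRR : Rᵀ * R = 1 := (Matrix.mem_orthogonalGroup_iff' (Fin m) ℝ).mp hR
  refine ⟨?_, dataMatrix y * U * Matrix.diagonal (fun j => (ν j)⁻¹) * R, ?_⟩
  · rw [Matrix.transpose_mul, Matrix.mul_assoc, ← Matrix.mul_assoc Uᵀ, h.orthonormal,
      Matrix.one_mul, hRR]
  · conv_lhs => rw [h.eq_transpose_mul hν]
    rw [Matrix.mul_assoc]

theorem IsDominant.loss_mul {n m N : ℕ} {y : Fin N → Vec n}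
    {U : Matrix (Fin n) (Fin m) ℝ} {ν : Fin m → ℝ} {c : ℝ}
    (h : IsDominant (covMatrix y y) U ν c) {R : Matrix (Fin m) (Fin m) ℝ}
    (hR : R ∈ Matrix.orthogonalGroup (Fin m) ℝ) :
    loss y (U * R) (U * R) = (covMatrix y y).trace - ∑ j, ν j := by
  have hRR : R * Rᵀ = 1 := (Matrix.mem_orthogonalGroup_iff (Fin m) ℝ).mp hR
  rw [loss_eq_add y (G := U) _ h.orthonormal, h.trace_eq, Matrix.transpose_mul, Matrix.mul_assoc U,
    ← Matrix.mul_assoc R, hRR, Matrix.one_mul, sub_self, Matrix.mul_zero]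
  · simp [frobSq]
  · rw [Matrix.mul_assoc, ← Matrix.mul_assoc Uᵀ, h.orthonormal, Matrix.one_mul]

theorem exists_loss_eq_add {n m N : ℕ} (hmn : m ≤ n) (y : Fin N → Vec n)
    (A Q : Matrix (Fin n) (Fin m) ℝ) :
    ∃ G : Matrix (Fin n) (Fin m) ℝ, Gᵀ * G = 1 ∧
      loss y A Q = frobSq (dataMatrix y * (Q * Aᵀ - G * Gᵀ)) +
        ((covMatrix y y).trace - (Gᵀ * covMatrix y y * G).trace) := by
  obtain ⟨k, rfl⟩ := Nat.exists_eq_add_of_le hmn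
  obtain ⟨G, B, hG, -, -, h1, hBA⟩ := exists_orthonormal_splitting A
  refine ⟨G, hG, loss_eq_add y Q hG ?_⟩
  conv_rhs => rw [← Matrix.one_mul A, ← h1, Matrix.add_mul, Matrix.mul_assoc B, hBA,
    Matrix.mul_zero, add_zero]

theorem IsDominant.isOptimal_mul {n m N : ℕ} (hmn : m ≤ n) {y : Fin N → Vec n}
    (hr : m ≤ (dataMatrix y).rank)
    {U : Matrix (Fin n) (Fin m) ℝ} {ν : Fin m → ℝ} {c : ℝ}
    (h : IsDominant (covMatrix y y) U ν c) {R : Matrix (Fin m) (Fin m) ℝ}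
    (hR : R ∈ Matrix.orthogonalGroup (Fin m) ℝ) : IsOptimal y (U * R) (U * R) := by
  refine ⟨h.isFeasible_mul (h.pos hr) hR, fun A' Q' _ => ?_⟩
  obtain ⟨G, hG, hl⟩ := exists_loss_eq_add hmn y A' Q'
  rw [h.loss_mul hR, hl]
  linarith [h.trace_le hG, frobSq_nonneg (dataMatrix y * (Q' * A'ᵀ - G * Gᵀ))]

theorem IsOptimal.eq_and_exists {n m N : ℕ} (hmn : m ≤ n) {y : Fin N → Vec n}
    (hr : m ≤ (dataMatrix y).rank) {A Q : Matrix (Fin n) (Fin m) ℝ} (h : IsOptimal y A Q) :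
    A = Q ∧ ∃ (U : Matrix (Fin n) (Fin m) ℝ) (ν : Fin m → ℝ) (c : ℝ),
      ∃ R ∈ Matrix.orthogonalGroup (Fin m) ℝ, IsDominant (covMatrix y y) U ν c ∧ Q = U * R := by
  obtain ⟨U, ν, hU⟩ := exists_isTopEigenvectors hmn (covMatrix_self_transpose y)
  obtain ⟨c, hU⟩ := (isTopEigenvectors_iff hmn (covMatrix_self_transpose y) U ν).mp hU
  have h1R := one_mem (Matrix.orthogonalGroup (Fin m) ℝ)
  have hle := h.2 (U * (1 : Matrix (Fin m) (Fin m) ℝ)) (U * (1 : Matrix (Fin m) (Fin m) ℝ))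
    (hU.isFeasible_mul (hU.pos hr) h1R)
  obtain ⟨G, hG, hl⟩ := exists_loss_eq_add hmn y A Q
  rw [hU.loss_mul h1R, hl] at hle
  have htr := hU.trace_le hG
  have hnn := frobSq_nonneg (dataMatrix y * (Q * Aᵀ - G * Gᵀ))
  obtain ⟨R, hR, δ, hV⟩ := hU.exists_rotation hG (by linarith)
  have hzero := frobSq_eq_zero (M := dataMatrix y * (Q * Aᵀ - G * Gᵀ)) (by linarith)
  have hRR : R * Rᵀ = 1 := (Matrix.mem_orthogonalGroup_iff (Fin m) ℝ).mp hR
  have hGG : G * Gᵀ = (G * R) * (G * R)ᵀ := by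
    rw [Matrix.transpose_mul, Matrix.mul_assoc, ← Matrix.mul_assoc R, hRR, Matrix.one_mul]
  rw [hGG] at hzero
  have hVf := hV.eq_transpose_mul (hV.pos hr)
  have hV1 := hV.orthonormal
  set V := G * R
  obtain ⟨hQ1, B, hQB⟩ := (isFeasible_iff y Q).mp h.1
  -- the columns of `Q` and `V` lie in the span of the data, where `Q Aᵀ` and `V Vᵀ` agree
  have hspan {p : ℕ} (W : Matrix (Fin n) (Fin p) ℝ) (B : Matrix (Fin N) (Fin p) ℝ)
      (hW : W = (dataMatrix y)ᵀ * B) : Wᵀ * (Q * Aᵀ - V * Vᵀ) = 0 := by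
    rw [hW, Matrix.transpose_mul, Matrix.transpose_transpose, Matrix.mul_assoc, hzero,
      Matrix.mul_zero]
  have hA : Aᵀ = Qᵀ * V * Vᵀ := by
    have := hspan Q B hQB
    rwa [Matrix.mul_sub, ← Matrix.mul_assoc, hQ1, Matrix.one_mul, sub_eq_zero,
      ← Matrix.mul_assoc] at this
  have hT : (Vᵀ * Q) * (Vᵀ * Q)ᵀ = 1 := by
    have := hspan V _ hVf
    rw [Matrix.mul_sub, sub_eq_zero, ← Matrix.mul_assoc Vᵀ V, hV1, Matrix.one_mul, hA] at this
    have := congrArg (· * V) this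
    simp only [Matrix.mul_assoc, hV1, Matrix.mul_one] at this
    simpa [Matrix.mul_assoc] using this
  have hT' : (Vᵀ * Q)ᵀ * (Vᵀ * Q) = 1 := mul_eq_one_comm.mp hT
  have hQV : Q = V * (Vᵀ * Q) := by
    rw [← sub_eq_zero]
    apply frobSq_eq_zero
    have hg := projection_residual_gram hV1 Q
    rw [Matrix.transpose_mul, Matrix.transpose_transpose] at hT'
    rw [frobSq_eq_trace', hg, hQ1, hT', sub_self, Matrix.trace_zero]
  have hAQ : A = Q := by
    have := congrArg Matrix.transpose hA
    rw [Matrix.transpose_transpose] at this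
    rw [this, hQV]
    simp [Matrix.mul_assoc]
    rw [← Matrix.mul_assoc Vᵀ V, hV1, Matrix.one_mul]
  exact ⟨hAQ, V, δ, c, Vᵀ * Q, (Matrix.mem_orthogonalGroup_iff (Fin m) ℝ).mpr hT, hV, hQV⟩

theorem isOptimal_iff {n m N : ℕ} (hmn : m ≤ n) {y : Fin N → Vec n}
    (hr : m ≤ (dataMatrix y).rank) (A Q : Matrix (Fin n) (Fin m) ℝ) :
    IsOptimal y A Q ↔ A = Q ∧ ∃ (U : Matrix (Fin n) (Fin m) ℝ) (ν : Fin m → ℝ),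
      ∃ R ∈ Matrix.orthogonalGroup (Fin m) ℝ,
        IsTopEigenvectors (covMatrix y y) U ν ∧ Q = U * R := by
  constructor
  · intro h
    obtain ⟨hA, U, ν, c, R, hR, hU, hQ⟩ := h.eq_and_exists hmn hr
    exact ⟨hA, U, ν, R, hR,
      (isTopEigenvectors_iff hmn (covMatrix_self_transpose y) U ν).mpr ⟨c, hU⟩, hQ⟩
  · rintro ⟨rfl, U, ν, R, hR, hU, rfl⟩
    obtain ⟨c, hU⟩ := (isTopEigenvectors_iff hmn (covMatrix_self_transpose y) U ν).mp hU
    exact hU.isOptimal_mul hmn hr hR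

theorem exists_isOptimal {n m N : ℕ} (hmn : m ≤ n) {y : Fin N → Vec n}
    (hr : m ≤ (dataMatrix y).rank) : ∃ Q : Matrix (Fin n) (Fin m) ℝ, IsOptimal y Q Q := by
  obtain ⟨U, ν, hU⟩ := exists_isTopEigenvectors hmn (covMatrix_self_transpose y)
  exact ⟨U, (isOptimal_iff hmn hr U U).mpr
    ⟨rfl, U, ν, 1, one_mem _, hU, (Matrix.mul_one U).symm⟩⟩

/-! ### The Procrustes alignment -/

/-- The Householder reflection in the hyperplane orthogonal to `v`; it is the identity for `v = 0`,
because then `2 / 0 = 0`. -/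
noncomputable def householder {k : ℕ} (v : Fin k → ℝ) : Matrix (Fin k) (Fin k) ℝ :=
  1 - (2 / (v ⬝ᵥ v)) • Matrix.vecMulVec v v

theorem householder_mem_orthogonalGroup {k : ℕ} (v : Fin k → ℝ) :
    householder v ∈ Matrix.orthogonalGroup (Fin k) ℝ := by
  rw [Matrix.mem_orthogonalGroup_iff]
  have ht : (householder v)ᵀ = householder v := by
    simp [householder, Matrix.transpose_vecMulVec]
  have hs : 2 / (v ⬝ᵥ v) * (2 / (v ⬝ᵥ v)) * (v ⬝ᵥ v) = 2 / (v ⬝ᵥ v) + 2 / (v ⬝ᵥ v) := by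
    by_cases h : v ⬝ᵥ v = 0
    · simp [h]
    · field_simp; norm_num
  rw [ht, householder, Matrix.mul_sub, Matrix.mul_one, Matrix.sub_mul,
    Matrix.one_mul, Matrix.smul_mul, Matrix.mul_smul, Matrix.vecMulVec_mul_vecMulVec,
    Matrix.vecMulVec_smul, smul_smul, smul_smul, hs, add_smul]
  abel

theorem trace_mul_vecMulVec {k : ℕ} (H : Matrix (Fin k) (Fin k) ℝ) (v w : Fin k → ℝ) :
    (H * Matrix.vecMulVec v w).trace = w ⬝ᵥ H *ᵥ v := by
  rw [Matrix.mul_vecMulVec, Matrix.trace_vecMulVec, dotProduct_comm]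

/-- A matrix whose trace cannot be increased by an orthogonal factor is symmetric and positive
semidefinite: one reflection gives nonnegativity of the quadratic form, and the product of two
reflections, in `eᵢ` and `eᵢ + b eⱼ`, gives symmetry. -/
theorem posSemidef_of_trace_mul_le {k : ℕ} {H : Matrix (Fin k) (Fin k) ℝ}
    (h : ∀ O ∈ Matrix.orthogonalGroup (Fin k) ℝ, (H * O).trace ≤ H.trace) : H.PosSemidef := by
  have hnn (v : Fin k → ℝ) : 0 ≤ v ⬝ᵥ H *ᵥ v := by
    by_cases hv : v = 0
    · simp [hv]
    have hpos : 0 < v ⬝ᵥ v := by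
      simpa using Matrix.dotProduct_star_self_pos_iff.mpr hv
    have h1 := h _ (householder_mem_orthogonalGroup v)
    rw [householder, Matrix.mul_sub, Matrix.mul_one, Matrix.mul_smul, Matrix.trace_sub,
      Matrix.trace_smul, trace_mul_vecMulVec, smul_eq_mul] at h1
    by_contra! hlt
    have := mul_neg_of_pos_of_neg (div_pos two_pos hpos) hlt
    linarith
  have hsym (i j : Fin k) : H i j = H j i := by
    by_cases hij : i = j
    · rw [hij]
    have key (b : ℝ) : b * (H j i - H i j) ≤ b ^ 2 * (H i i + H j j) := by
      let v : Fin k → ℝ := Pi.single i 1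
      let w : Fin k → ℝ := Pi.single i 1 + b • Pi.single j 1
      have h1 := h _ (mul_mem (householder_mem_orthogonalGroup v) (householder_mem_orthogonalGroup w))
      have hvv : v ⬝ᵥ v = 1 := by simp [v]
      have hvw : v ⬝ᵥ w = 1 := by simp [v, w, hij]
      have hww : w ⬝ᵥ w = 1 + b ^ 2 := by
        simp [w, hij, Ne.symm hij, dotProduct_add]; ring
      have h2 : v ⬝ᵥ H *ᵥ v = H i i := by simp [v]
      have h3 : w ⬝ᵥ H *ᵥ w = H i i + b ^ 2 * H j j + b * (H i j + H j i) := by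
        simp [w, add_dotProduct, Matrix.mulVec_add, Matrix.mulVec_smul]; ring
      have h4 : w ⬝ᵥ H *ᵥ v = H i i + b * H j i := by
        simp [v, w, add_dotProduct]
      rw [householder, householder, hvv, hww, Matrix.sub_mul, Matrix.one_mul, Matrix.mul_sub,
        Matrix.mul_sub, Matrix.mul_sub, Matrix.mul_one, Matrix.mul_one, Matrix.smul_mul,
        Matrix.mul_smul (Matrix.vecMulVec v v), Matrix.vecMulVec_mul_vecMulVec, hvw, one_smul,
        Matrix.mul_sub, Matrix.mul_smul, Matrix.mul_smul, Matrix.mul_smul, Matrix.mul_smul] at h1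
      simp only [Matrix.trace_sub, Matrix.trace_smul, trace_mul_vecMulVec, smul_eq_mul] at h1
      rw [h2, h3, h4] at h1
      have hp : 0 < 1 + b ^ 2 := by positivity
      have h5 : (1 + b ^ 2) * (2 / (1 + b ^ 2)) = 2 := mul_div_cancel₀ _ hp.ne'
      have h6 : 2 / (1 + b ^ 2) * (b * (H j i - H i j) - b ^ 2 * (H i i + H j j)) ≤ 0 := by
        linear_combination h1 - H i i * h5
      linarith [nonpos_of_mul_nonpos_right h6 (div_pos two_pos hp)]
    have hi : 0 ≤ H i i := by simpa using hnn (Pi.single i 1)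
    have hj : 0 ≤ H j j := by simpa using hnn (Pi.single j 1)
    -- `b = d / (s + 1)` is small enough for the quadratic term not to absorb the linear one
    set d := H j i - H i j with hd
    set s := H i i + H j j with hs
    have hs0 : 0 ≤ s := add_nonneg hi hj
    have h1 := key (d / (s + 1))
    have h2 : d ^ 2 * (s + 1) ≤ d ^ 2 * s := by
      have hp : 0 < s + 1 := by linarith
      have h3 := mul_le_mul_of_nonneg_left h1 (sq_nonneg (s + 1))
      have e1 : (s + 1) ^ 2 * (d / (s + 1) * d) = d ^ 2 * (s + 1) := by field_simp
      have e2 : (s + 1) ^ 2 * ((d / (s + 1)) ^ 2 * s) = d ^ 2 * s := by field_simp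
      rwa [e1, e2] at h3
    have h3 : d = 0 := pow_eq_zero_iff two_ne_zero |>.mp (le_antisymm (by linarith) (sq_nonneg d))
    linarith
  refine Matrix.PosSemidef.of_dotProduct_mulVec_nonneg ?_ fun v => by simpa using hnn v
  ext i j
  simpa using hsym j i

theorem frobSq_sub_mul {n m : ℕ} {V Q : Matrix (Fin n) (Fin m) ℝ} (hV : Vᵀ * V = 1)
    (hQ : Qᵀ * Q = 1) {R : Matrix (Fin m) (Fin m) ℝ} (hR : R ∈ Matrix.orthogonalGroup (Fin m) ℝ) :
    frobSq (V - Q * R) = 2 * m - 2 * (Qᵀ * V * Rᵀ).trace := by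
  have hRR : Rᵀ * R = 1 := (Matrix.mem_orthogonalGroup_iff' (Fin m) ℝ).mp hR
  have h1 : (V - Q * R)ᵀ * (V - Q * R) = 1 + 1 - (Rᵀ * (Qᵀ * V) + (Rᵀ * (Qᵀ * V))ᵀ) := by
    rw [Matrix.transpose_sub, Matrix.sub_mul, Matrix.mul_sub, Matrix.mul_sub, hV,
      Matrix.transpose_mul Q R, Matrix.mul_assoc Rᵀ Qᵀ (Q * R), ← Matrix.mul_assoc Qᵀ Q R, hQ,
      Matrix.one_mul, hRR]
    simp only [Matrix.transpose_mul, Matrix.transpose_transpose, Matrix.mul_assoc]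
    abel
  rw [frobSq_eq_trace', h1, Matrix.trace_sub, Matrix.trace_add, Matrix.trace_add,
    Matrix.trace_transpose, Matrix.trace_mul_comm Rᵀ, Matrix.trace_one, Fintype.card_fin]
  ring

theorem alignment_mem {n m : ℕ} (V Q : Matrix (Fin n) (Fin m) ℝ) :
    alignment V Q ∈ Matrix.orthogonalGroup (Fin m) ℝ :=
  (Classical.choose_spec (exists_procrustes V Q)).1

/-- The alignment turns the cross-Gram matrix `Qᵀ V` into its positive semidefinite polar factor. -/
theorem posSemidef_aligned {n m : ℕ} {V Q : Matrix (Fin n) (Fin m) ℝ} (hV : Vᵀ * V = 1)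
    (hQ : Qᵀ * Q = 1) : (Qᵀ * (V * (alignment V Q)ᵀ)).PosSemidef := by
  refine posSemidef_of_trace_mul_le fun O hO => ?_
  have hmin := (Classical.choose_spec (exists_procrustes V Q)).2
  have hR := alignment_mem V Q
  have hOR := mul_mem (Matrix.transpose_mem_unitaryGroup_iff.mpr hO) hR
  have := hmin _ hOR
  change frobSq (V - Q * alignment V Q) ≤ _ at this
  rw [frobSq_sub_mul hV hQ hR, frobSq_sub_mul hV hQ hOR, Matrix.transpose_mul,
    Matrix.transpose_transpose] at this
  simp only [Matrix.mul_assoc] at this ⊢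
  linarith

/-- Since `H² - 1 = (H + 1) (H - 1)` and `H + 1 ≥ 1`. -/
theorem frobSq_sub_one_le {k : ℕ} {H : Matrix (Fin k) (Fin k) ℝ} (hH : H.PosSemidef) :
    frobSq (H - 1) ≤ frobSq (H * H - 1) := by
  have hHt : Hᵀ = H := by
    have := hH.isHermitian.eq
    rwa [Matrix.conjTranspose_eq_transpose_of_trivial] at this
  have hHH : (H * H).PosSemidef := by
    have := Matrix.posSemidef_conjTranspose_mul_self H
    rwa [Matrix.conjTranspose_eq_transpose_of_trivial, hHt] at this
  have h1 := ((hHH.add (hH.add hH)).conjTranspose_mul_mul_same (H - 1)).trace_nonneg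
  rw [Matrix.conjTranspose_eq_transpose_of_trivial] at h1
  have h2 : (H * H - 1)ᵀ * (H * H - 1) =
      (H - 1)ᵀ * (H - 1) + (H - 1)ᵀ * (H * H + (H + H)) * (H - 1) := by
    simp only [Matrix.transpose_sub, Matrix.transpose_mul, hHt, Matrix.transpose_one]
    noncomm_ring
  rw [frobSq_eq_trace', frobSq_eq_trace', h2, Matrix.trace_add]
  linarith

/-! ### First-order calculus for matrices and convergence of aligned frames -/

/-- If `f` agrees with the linear map `L` to first order at `0`, then so does `A f B` with
`A₀ L B₀`, where `A` and `B` need only converge, to `A₀` and `B₀`. -/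
theorem isLittleO_mul_mul_entry {E : Type*} [NormedAddCommGroup E] [NormedSpace ℝ E]
    [FiniteDimensional ℝ E] {a b c d : ℕ} {l : Filter E} {f : E → Matrix (Fin b) (Fin c) ℝ}
    {L : E →ₗ[ℝ] Matrix (Fin b) (Fin c) ℝ}
    (hf : ∀ p q, (fun ε => f ε p q - L ε p q) =o[l] fun ε => ε)
    {A : E → Matrix (Fin a) (Fin b) ℝ} {A₀ : Matrix (Fin a) (Fin b) ℝ} (hA : Tendsto A l (𝓝 A₀))
    {B : E → Matrix (Fin c) (Fin d) ℝ} {B₀ : Matrix (Fin c) (Fin d) ℝ} (hB : Tendsto B l (𝓝 B₀))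
    (i : Fin a) (j : Fin d) :
    (fun ε => (A ε * f ε * B ε) i j - (A₀ * L ε * B₀) i j) =o[l] fun ε => ε := by
  have hAe (p) : Tendsto (fun ε => A ε i p) l (𝓝 (A₀ i p)) :=
    (continuous_id.matrix_elem i p).continuousAt.tendsto.comp hA
  have hBe (q) : Tendsto (fun ε => B ε q j) l (𝓝 (B₀ q j)) :=
    (continuous_id.matrix_elem q j).continuousAt.tendsto.comp hB
  have hL (p q) : (fun ε => L ε p q) =O[l] fun ε => ε :=
    (LinearMap.toContinuousLinearMap (Matrix.entryLinearMap ℝ ℝ p q ∘ₗ L)).isBigO_id l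
  have hterm (p q) : (fun ε => A ε i p * f ε p q * B ε q j - A₀ i p * L ε p q * B₀ q j)
      =o[l] fun ε => ε := by
    have h1 : (fun ε => A ε i p * B ε q j * (f ε p q - L ε p q)) =o[l] fun ε => ε := by
      refine Asymptotics.isLittleO_norm_right.mp ?_
      simpa using (((hAe p).mul (hBe q)).isBigO_one ℝ).mul_isLittleO (hf p q).norm_right
    have h2 : (fun ε => (A ε i p * B ε q j - A₀ i p * B₀ q j) * L ε p q) =o[l] fun ε => ε := by
      have h3 : Tendsto (fun ε => A ε i p * B ε q j - A₀ i p * B₀ q j) l (𝓝 0) := by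
        simpa using ((hAe p).mul (hBe q)).sub_const (A₀ i p * B₀ q j)
      refine Asymptotics.isLittleO_norm_right.mp ?_
      simpa using ((Asymptotics.isLittleO_one_iff ℝ).mpr h3).mul_isBigO (hL p q).norm_right
    refine (h1.add h2).congr_left fun ε => ?_
    ring
  have hsum := Asymptotics.IsLittleO.fun_sum (s := Finset.univ) fun q (_ : q ∈ Finset.univ) =>
    Asymptotics.IsLittleO.fun_sum (s := Finset.univ) fun p (_ : p ∈ Finset.univ) => hterm p q
  refine hsum.congr_left fun ε => ?_
  simp only [Matrix.mul_apply, Finset.sum_mul, Finset.sum_sub_distrib]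

theorem hasFDerivWithinAt_of_isLittleO_entry {E : Type*} [NormedAddCommGroup E] [NormedSpace ℝ E]
    {n m : ℕ} {S : Set E} {f : E → Matrix (Fin n) (Fin m) ℝ} (h0 : f 0 = 0)
    {G : E →L[ℝ] Matrix (Fin n) (Fin m) ℝ}
    (h : ∀ i j, (fun ε => f ε i j - G ε i j) =o[𝓝[S] 0] fun ε => ε) :
    HasFDerivWithinAt f G S 0 := by
  let _ : NormedAddCommGroup (Matrix (Fin n) (Fin m) ℝ) := Matrix.normedAddCommGroup
  let _ : NormedSpace ℝ (Matrix (Fin n) (Fin m) ℝ) := Matrix.normedSpace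
  refine HasFDerivWithinAt.of_isLittleO ?_
  simp only [h0, sub_zero]
  exact Asymptotics.isLittleO_pi.mpr fun i => Asymptotics.isLittleO_pi.mpr fun j => h i j

theorem tendsto_of_frobSq {ι : Type*} {l : Filter ι} {n m : ℕ} {F : ι → Matrix (Fin n) (Fin m) ℝ}
    {F₀ : Matrix (Fin n) (Fin m) ℝ} (h : Tendsto (fun t => frobSq (F t - F₀)) l (𝓝 0)) :
    Tendsto F l (𝓝 F₀) := by
  refine tendsto_pi_nhds.mpr fun i => tendsto_pi_nhds.mpr fun j => ?_
  have h1 : Tendsto (fun t => (F t i j - F₀ i j) ^ 2) l (𝓝 0) :=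
    squeeze_zero (fun _ => sq_nonneg _) (fun t => sq_le_frobSq (F t - F₀) i j) h
  have h2 := h1.sqrt
  simp only [Real.sqrt_sq_eq_abs, Real.sqrt_zero] at h2
  exact tendsto_sub_nhds_zero_iff.mp ((tendsto_zero_iff_abs_tendsto_zero _).mpr h2)

theorem continuous_frobSq {n m : ℕ} : Continuous (frobSq : Matrix (Fin n) (Fin m) ℝ → ℝ) := by
  unfold frobSq
  exact continuous_finsetSum _ fun i _ => continuous_finsetSum _ fun j _ =>
    (continuous_id.matrix_elem i j).pow 2

/-- A crude bound, uniform in the orthonormal frame `V`. -/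
theorem trace_conj_le {n m : ℕ} {V : Matrix (Fin n) (Fin m) ℝ} (hV : Vᵀ * V = 1)
    (E : Matrix (Fin n) (Fin n) ℝ) : (Vᵀ * E * V).trace ≤ m * ∑ b, ∑ a, |E a b| := by
  have hle (a : Fin n) (j : Fin m) : |V a j| ≤ 1 := by
    have h1 : ∑ a, V a j ^ 2 = 1 := by
      have := congrFun (congrFun hV j) j
      simpa [Matrix.mul_apply, pow_two] using this
    have h2 : V a j ^ 2 ≤ 1 := by
      rw [← h1]
      exact Finset.single_le_sum (f := fun a => V a j ^ 2) (fun _ _ => sq_nonneg _)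
        (Finset.mem_univ a)
    exact abs_le_one_iff_mul_self_le_one.mpr (by rwa [← pow_two])
  have h3 : (Vᵀ * E * V).trace = ∑ j : Fin m, ∑ b, ∑ a, V a j * E a b * V b j := by
    simp only [Matrix.trace, Matrix.diag_apply, Matrix.mul_apply, Matrix.transpose_apply,
      Finset.sum_mul]
  have h4 : (m : ℝ) * ∑ b, ∑ a, |E a b| = ∑ _j : Fin m, ∑ b, ∑ a, |E a b| := by
    simp
  rw [h3, h4]
  refine Finset.sum_le_sum fun j _ => Finset.sum_le_sum fun b _ => Finset.sum_le_sum fun a _ => ?_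
  calc V a j * E a b * V b j ≤ |V a j * E a b * V b j| := le_abs_self _
    _ = |V a j| * |E a b| * |V b j| := by rw [abs_mul, abs_mul]
    _ ≤ 1 * |E a b| * 1 := by
        gcongr
        · exact hle a j
        · exact hle b j
    _ = |E a b| := by ring

/-- An orthonormal frame of a dominant invariant subspace of `C`: the properties of dominant
eigenvectors that survive a rotation of the frame. -/
structure IsPrincipalFrame {n m : ℕ} (C : Matrix (Fin n) (Fin n) ℝ)
    (V : Matrix (Fin n) (Fin m) ℝ) : Prop where
  orthonormal : Vᵀ * V = 1
  invariant : C * V = V * (Vᵀ * C * V)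
  trace_le : ∀ W : Matrix (Fin n) (Fin m) ℝ, Wᵀ * W = 1 →
    (Wᵀ * C * W).trace ≤ (Vᵀ * C * V).trace

theorem IsPrincipalFrame.mul {n m : ℕ} {C : Matrix (Fin n) (Fin n) ℝ}
    {V : Matrix (Fin n) (Fin m) ℝ} (h : IsPrincipalFrame C V) {R : Matrix (Fin m) (Fin m) ℝ}
    (hR : R ∈ Matrix.orthogonalGroup (Fin m) ℝ) : IsPrincipalFrame C (V * R) := by
  have hRR : Rᵀ * R = 1 := (Matrix.mem_orthogonalGroup_iff' (Fin m) ℝ).mp hR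
  have hRR' : R * Rᵀ = 1 := (Matrix.mem_orthogonalGroup_iff (Fin m) ℝ).mp hR
  have hconj : (V * R)ᵀ * C * (V * R) = Rᵀ * (Vᵀ * C * V) * R := by
    rw [Matrix.transpose_mul]; simp only [Matrix.mul_assoc]
  refine ⟨?_, ?_, fun W hW => ?_⟩
  · rw [Matrix.transpose_mul, Matrix.mul_assoc, ← Matrix.mul_assoc Vᵀ, h.orthonormal,
      Matrix.one_mul, hRR]
  · rw [hconj, ← Matrix.mul_assoc C, h.invariant, Matrix.mul_assoc V R, ← Matrix.mul_assoc R,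
      ← Matrix.mul_assoc R, hRR', Matrix.one_mul, Matrix.mul_assoc V]
  · rw [hconj, Matrix.trace_mul_comm (Rᵀ * _), ← Matrix.mul_assoc, hRR', Matrix.one_mul]
    exact h.trace_le W hW

theorem IsDominant.isPrincipalFrame {n m : ℕ} {C : Matrix (Fin n) (Fin n) ℝ}
    {U : Matrix (Fin n) (Fin m) ℝ} {ν : Fin m → ℝ} {c : ℝ} (h : IsDominant C U ν c) :
    IsPrincipalFrame C U := by
  have hUCU : Uᵀ * C * U = Matrix.diagonal ν := by
    rw [Matrix.mul_assoc, h.eigen, ← Matrix.mul_assoc, h.orthonormal, Matrix.one_mul]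
  refine ⟨h.orthonormal, by rw [hUCU, h.eigen], fun W hW => ?_⟩
  rw [h.trace_eq]
  exact h.trace_le hW

theorem continuous_dataMatrix {n N : ℕ} :
    Continuous (dataMatrix : (Fin N → Vec n) → Matrix (Fin N) (Fin n) ℝ) := by
  unfold dataMatrix
  refine continuous_pi fun k => continuous_pi fun i => ?_
  simp only [Matrix.of_apply]
  fun_prop

theorem tendsto_dataMatrix {n N : ℕ} (x : Fin N → Vec n) {l : Filter (Fin N → Vec n)}
    (hl : l ≤ 𝓝 0) : Tendsto (fun ε => dataMatrix (x + ε)) l (𝓝 (dataMatrix x)) := by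
  have h : Continuous fun ε : Fin N → Vec n => dataMatrix (x + ε) :=
    continuous_dataMatrix.comp (continuous_const.add continuous_id)
  have := h.tendsto 0
  rw [add_zero] at this
  exact this.mono_left hl

/-- Aligned frames of dominant subspaces converge to `Q` when the matrices converge to `C₀` and the
spectrum of `C₀` has a gap below `lam`. -/
theorem tendsto_aligned_principalFrame {ι : Type*} {l : Filter ι} {n m : ℕ}
    {C : ι → Matrix (Fin n) (Fin n) ℝ} {C₀ : Matrix (Fin n) (Fin n) ℝ} (hC : Tendsto C l (𝓝 C₀))
    {Q : Matrix (Fin n) (Fin m) ℝ} {lam : Fin m → ℝ} {c : ℝ} (hQ : IsDominant C₀ Q lam c)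
    (hgap : ∀ j, c < lam j) {F : ι → Matrix (Fin n) (Fin m) ℝ}
    (hF : ∀ᶠ t in l, IsPrincipalFrame (C t) (F t) ∧ (Qᵀ * F t).PosSemidef) :
    Tendsto F l (𝓝 Q) := by
  have hCe (a b) : Tendsto (fun t => C t a b) l (𝓝 (C₀ a b)) :=
    (continuous_id.matrix_elem a b).continuousAt.tendsto.comp hC
  -- the trace that `F t` loses with respect to `C₀` is bounded by the size of `C t - C₀`
  have hbound : ∀ᶠ t in l, ∑ j, (lam j - c) * ∑ i, (Q - F t * ((F t)ᵀ * Q)) i j ^ 2 ≤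
      m * ∑ b, ∑ a, |(C t - C₀) a b| + ((Qᵀ * C₀ * Q).trace - (Qᵀ * C t * Q).trace) := by
    filter_upwards [hF] with t ⟨ht, _⟩
    have h1 := hQ.trace_gap ht.orthonormal
    have h2 := (hQ.posSemidef.conjTranspose_mul_mul_same (F t)).trace_nonneg
    rw [Matrix.conjTranspose_eq_transpose_of_trivial] at h2
    have h3 := ht.trace_le Q hQ.orthonormal
    have h4 := trace_conj_le ht.orthonormal (C t - C₀)
    rw [Matrix.mul_sub, Matrix.sub_mul, Matrix.trace_sub] at h4
    rw [← hQ.trace_eq] at h1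
    linarith
  have hlim : Tendsto (fun t => m * ∑ b, ∑ a, |(C t - C₀) a b| +
      ((Qᵀ * C₀ * Q).trace - (Qᵀ * C t * Q).trace)) l (𝓝 0) := by
    have hc : Continuous fun D : Matrix (Fin n) (Fin n) ℝ => (m : ℝ) * ∑ b, ∑ a, |(D - C₀) a b| +
        ((Qᵀ * C₀ * Q).trace - (Qᵀ * D * Q).trace) := by
      refine Continuous.add (continuous_const.mul (continuous_finsetSum _ fun b _ =>
        continuous_finsetSum _ fun a _ => ?_)) ?_
      · exact ((continuous_id.sub continuous_const).matrix_elem a b).abs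
      · exact continuous_const.sub (by fun_prop)
    have := (hc.tendsto C₀).comp hC
    simpa [Function.comp_def] using this
  have hZ : Tendsto (fun t => Q - F t * ((F t)ᵀ * Q)) l (𝓝 0) := by
    apply tendsto_of_frobSq
    simp only [sub_zero]
    have hcol (j : Fin m) :
        Tendsto (fun t => ∑ i, (Q - F t * ((F t)ᵀ * Q)) i j ^ 2) l (𝓝 0) := by
      have h1 := hlim.const_mul (lam j - c)⁻¹
      rw [mul_zero] at h1
      refine squeeze_zero' (Eventually.of_forall fun t => Finset.sum_nonneg fun _ _ => sq_nonneg _)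
        ?_ h1
      filter_upwards [hbound] with t ht
      rw [le_inv_mul_iff₀ (sub_pos.mpr (hgap j))]
      refine le_trans ?_ ht
      exact Finset.single_le_sum
        (f := fun j => (lam j - c) * ∑ i, (Q - F t * ((F t)ᵀ * Q)) i j ^ 2)
        (fun j _ => mul_nonneg (sub_nonneg.mpr (hQ.le j))
          (Finset.sum_nonneg fun _ _ => sq_nonneg _)) (Finset.mem_univ j)
    have := tendsto_finsetSum Finset.univ fun j _ => hcol j
    simp only [Finset.sum_const_zero] at this
    refine this.congr fun t => ?_
    rw [frobSq, Finset.sum_comm]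
  have hH : Tendsto (fun t => Qᵀ * F t) l (𝓝 1) := by
    apply tendsto_of_frobSq
    have hc : Continuous fun Z : Matrix (Fin n) (Fin m) ℝ => frobSq (-(Qᵀ * Z)) :=
      continuous_frobSq.comp (by fun_prop)
    have h1 := (hc.tendsto 0).comp hZ
    simp only [Matrix.mul_zero, neg_zero] at h1
    have h00 : frobSq (0 : Matrix (Fin m) (Fin m) ℝ) = 0 := by simp [frobSq]
    rw [h00] at h1
    refine squeeze_zero' (Eventually.of_forall fun t => frobSq_nonneg _) ?_ h1
    filter_upwards [hF] with t ⟨_, ht⟩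
    have hsym : (F t)ᵀ * Q = Qᵀ * F t := by
      have := ht.isHermitian.eq
      rwa [Matrix.conjTranspose_eq_transpose_of_trivial, Matrix.transpose_mul,
        Matrix.transpose_transpose] at this
    have e : -(Qᵀ * (Q - F t * ((F t)ᵀ * Q))) = (Qᵀ * F t) * (Qᵀ * F t) - 1 := by
      rw [Matrix.mul_sub, hQ.orthonormal, hsym, Matrix.mul_assoc]
      abel
    simp only [Function.comp_apply]
    rw [e]
    exact frobSq_sub_one_le ht
  apply tendsto_of_frobSq
  have hc : Continuous fun H : Matrix (Fin m) (Fin m) ℝ => 2 * (m : ℝ) - 2 * H.trace := by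
    fun_prop
  have h1 := (hc.tendsto 1).comp hH
  simp only [Matrix.trace_one, Fintype.card_fin, sub_self] at h1
  refine h1.congr' ?_
  filter_upwards [hF] with t ⟨ht, _⟩
  have := frobSq_sub_mul ht.orthonormal hQ.orthonormal (one_mem (Matrix.orthogonalGroup (Fin m) ℝ))
  rw [Matrix.mul_one, Matrix.transpose_one, Matrix.mul_one] at this
  rw [this]
  rfl

/-! ### The derivative of the aligned frame -/

theorem tendsto_matrix_mul {ι : Type*} {l : Filter ι} {a b c : ℕ}
    {F : ι → Matrix (Fin a) (Fin b) ℝ} {G : ι → Matrix (Fin b) (Fin c) ℝ}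
    {A : Matrix (Fin a) (Fin b) ℝ} {B : Matrix (Fin b) (Fin c) ℝ}
    (hF : Tendsto F l (𝓝 A)) (hG : Tendsto G l (𝓝 B)) :
    Tendsto (fun t => F t * G t) l (𝓝 (A * B)) :=
  ((continuous_fst.matrix_mul continuous_snd).tendsto (A, B)).comp (hF.prodMk_nhds hG)

theorem tendsto_matrix_inv {ι : Type*} {l : Filter ι} {k : ℕ} {F : ι → Matrix (Fin k) (Fin k) ℝ}
    {A B : Matrix (Fin k) (Fin k) ℝ} (hF : Tendsto F l (𝓝 A)) (hAB : A * B = 1) :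
    Tendsto (fun t => (F t)⁻¹) l (𝓝 B) := by
  have hdet : IsUnit A.det := Matrix.isUnit_det_of_right_inverse hAB
  rw [← Matrix.inv_eq_right_inv hAB]
  refine (continuousAt_matrix_inv A ?_).tendsto.comp hF
  exact NormedRing.inverse_continuousAt hdet.unit

theorem eventually_isUnit_det {ι : Type*} {l : Filter ι} {k : ℕ}
    {F : ι → Matrix (Fin k) (Fin k) ℝ} {A B : Matrix (Fin k) (Fin k) ℝ}
    (hF : Tendsto F l (𝓝 A)) (hAB : A * B = 1) : ∀ᶠ t in l, IsUnit (F t).det := by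
  have h1 : Tendsto (fun t => (F t).det) l (𝓝 A.det) :=
    (continuous_id.matrix_det.tendsto A).comp hF
  filter_upwards [h1.eventually_ne (Matrix.isUnit_det_of_right_inverse hAB).ne_zero] with t ht
  exact ht.isUnit

/-- `dataMatrix` as a linear map. -/
def dataMatrixₗ (n N : ℕ) : (Fin N → Vec n) →ₗ[ℝ] Matrix (Fin N) (Fin n) ℝ where
  toFun := dataMatrix
  map_add' _ _ := rfl
  map_smul' _ _ := rfl

/-- The derivative of the aligned encoder at zero noise, as a linear map of the noise array. -/
noncomputable def firstOrder {n m N : ℕ} (x : Fin N → Vec n) (Q : Matrix (Fin n) (Fin m) ℝ)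
    (lam : Fin m → ℝ) : (Fin N → Vec n) →ₗ[ℝ] Matrix (Fin n) (Fin m) ℝ where
  toFun ε := (1 - Q * Qᵀ) * (dataMatrix ε)ᵀ *
    (dataMatrix x * Q * Matrix.diagonal fun j => (lam j)⁻¹)
  map_add' ε δ := by
    rw [show dataMatrix (ε + δ) = dataMatrix ε + dataMatrix δ from rfl, Matrix.transpose_add,
      Matrix.mul_add, Matrix.add_mul]
  map_smul' r ε := by
    rw [show dataMatrix (r • ε) = r • dataMatrix ε from rfl, Matrix.transpose_smul,
      Matrix.mul_smul, Matrix.smul_mul, RingHom.id_apply]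

theorem firstOrder_unitNoise {n m N : ℕ} (x : Fin N → Vec n) (Q : Matrix (Fin n) (Fin m) ℝ)
    (lam : Fin m → ℝ) (k : Fin N) (i : Fin n) :
    firstOrder x Q lam (unitNoise k i) = sensitivity Q lam (x k) i := by
  have h : (dataMatrix (unitNoise k i))ᵀ * dataMatrix x =
      Matrix.vecMulVec (Pi.single i 1) (x k) := by
    ext a b
    rw [Matrix.mul_apply, Finset.sum_eq_single k]
    · simp [dataMatrix, unitNoise, Matrix.vecMulVec_apply, Pi.single_apply]
    · intro l _ hl
      simp [dataMatrix, unitNoise, hl]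
    · simp
  change (1 - Q * Qᵀ) * (dataMatrix (unitNoise k i))ᵀ *
    (dataMatrix x * Q * Matrix.diagonal fun j => (lam j)⁻¹) = _
  rw [sensitivity, ← h]
  simp only [Matrix.mul_assoc]

theorem diagonal_mul_inv {m : ℕ} {lam : Fin m → ℝ} (h : ∀ j, 0 < lam j) :
    Matrix.diagonal lam * Matrix.diagonal (fun j => (lam j)⁻¹) = 1 := by
  rw [Matrix.diagonal_mul_diagonal, ← Matrix.diagonal_one]
  congr 1
  ext j
  exact mul_inv_cancel₀ (h j).ne'

theorem tendsto_covMatrix {n N : ℕ} (x : Fin N → Vec n) {l : Filter (Fin N → Vec n)}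
    (hl : l ≤ 𝓝 0) :
    Tendsto (fun ε => covMatrix (x + ε) (x + ε)) l (𝓝 (covMatrix x x)) := by
  simp only [covMatrix_eq]
  have hY := tendsto_dataMatrix x hl
  have hc : Continuous fun Y : Matrix (Fin N) (Fin n) ℝ => Yᵀ * Y := by fun_prop
  exact (hc.tendsto _).comp hY

/-- The first-order expansion of aligned frames of dominant subspaces at zero noise. -/
theorem isLittleO_aligned_principalFrame {n m N : ℕ} {x : Fin N → Vec n}
    {Q : Matrix (Fin n) (Fin m) ℝ} {lam : Fin m → ℝ} (hQ : IsDominant (covMatrix x x) Q lam 0)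
    (hlam : ∀ j, 0 < lam j) (hx : dataMatrix x * Q * Qᵀ = dataMatrix x)
    {l : Filter (Fin N → Vec n)} (hl : l ≤ 𝓝 0)
    {F : (Fin N → Vec n) → Matrix (Fin n) (Fin m) ℝ}
    (hF : ∀ᶠ ε in l, IsPrincipalFrame (covMatrix (x + ε) (x + ε)) (F ε) ∧
      (Qᵀ * F ε).PosSemidef) (i : Fin n) (j : Fin m) :
    (fun ε => (F ε - Q) i j - firstOrder x Q lam ε i j) =o[l] fun ε => ε := by
  set P := 1 - Q * Qᵀ with hP
  set C := fun ε => covMatrix (x + ε) (x + ε)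
  have hC : Tendsto C l (𝓝 (covMatrix x x)) := tendsto_covMatrix x hl
  have hFQ : Tendsto F l (𝓝 Q) := tendsto_aligned_principalFrame hC hQ hlam hF
  have hFQt : Tendsto (fun ε => (F ε)ᵀ) l (𝓝 Qᵀ) :=
    (continuous_id.matrix_transpose.tendsto Q).comp hFQ
  have hPQ : P * Q = 0 := by
    rw [hP, Matrix.sub_mul, Matrix.one_mul, Matrix.mul_assoc, hQ.orthonormal, Matrix.mul_one,
      sub_self]
  have hPt : Pᵀ = P := by simp [hP]
  have hPP : Pᵀ * P = P := by
    rw [hPt]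
    nth_rewrite 2 [hP]
    rw [Matrix.mul_sub, Matrix.mul_one, ← Matrix.mul_assoc, hPQ, Matrix.zero_mul, sub_zero]
  have hPx : P * (dataMatrix x)ᵀ = 0 := by
    have := congrArg Matrix.transpose hx
    rw [Matrix.transpose_mul, Matrix.transpose_mul, Matrix.transpose_transpose,
      ← Matrix.mul_assoc] at this
    rw [hP, Matrix.sub_mul, this, Matrix.one_mul, sub_self]
  have hM : Tendsto (fun ε => (F ε)ᵀ * C ε * F ε) l (𝓝 (Matrix.diagonal lam)) := by
    have h1 := tendsto_matrix_mul (tendsto_matrix_mul hFQt hC) hFQ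
    rwa [Matrix.mul_assoc Qᵀ, hQ.eigen, ← Matrix.mul_assoc, hQ.orthonormal, Matrix.one_mul] at h1
  have hg : Tendsto (fun ε => dataMatrix (x + ε) * F ε * ((F ε)ᵀ * C ε * F ε)⁻¹) l
      (𝓝 (dataMatrix x * Q * Matrix.diagonal fun j => (lam j)⁻¹)) :=
    tendsto_matrix_mul (tendsto_matrix_mul (tendsto_dataMatrix x hl) hFQ)
      (tendsto_matrix_inv hM (diagonal_mul_inv hlam))
  -- the component of the frame orthogonal to `Q`
  have hZeq : ∀ᶠ ε in l, P * (dataMatrix ε)ᵀ *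
      (dataMatrix (x + ε) * F ε * ((F ε)ᵀ * C ε * F ε)⁻¹) = P * F ε := by
    filter_upwards [hF, eventually_isUnit_det hM (diagonal_mul_inv hlam)] with ε ⟨hε, _⟩ hdet
    have h1 : P * (dataMatrix ε)ᵀ = P * (dataMatrix (x + ε))ᵀ := by
      rw [show dataMatrix (x + ε) = dataMatrix x + dataMatrix ε from rfl, Matrix.transpose_add,
        Matrix.mul_add, hPx, zero_add]
    calc P * (dataMatrix ε)ᵀ * (dataMatrix (x + ε) * F ε * ((F ε)ᵀ * C ε * F ε)⁻¹)
        = P * (C ε * F ε) * ((F ε)ᵀ * C ε * F ε)⁻¹ := by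
          rw [h1, show C ε = _ from covMatrix_eq _ _]
          simp only [Matrix.mul_assoc]
      _ = P * F ε := by
          rw [hε.invariant, ← Matrix.mul_assoc P, Matrix.mul_nonsing_inv_cancel_right _ _ hdet]
  have hZ (p : Fin n) (q : Fin m) :
      (fun ε => (P * F ε) p q - firstOrder x Q lam ε p q) =o[l] fun ε => ε := by
    have h1 := isLittleO_mul_mul_entry (f := fun ε => (dataMatrix ε)ᵀ)
      (L := (Matrix.transposeLinearEquiv (Fin N) (Fin n) ℝ ℝ).toLinearMap ∘ₗ dataMatrixₗ n N)
      (l := l) (fun p q => by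
        refine (Asymptotics.isLittleO_zero (fun ε : Fin N → Vec n => ε) l).congr_left fun ε => ?_
        exact (sub_self _).symm)
      (tendsto_const_nhds (x := P)) hg p q
    refine h1.congr' ?_ EventuallyEq.rfl
    filter_upwards [hZeq] with ε hε
    rw [hε]
    rfl
  have hZ0 : Tendsto (fun ε => P * F ε) l (𝓝 0) := by
    have := tendsto_matrix_mul (tendsto_const_nhds (x := P)) hFQ
    rwa [hPQ] at this
  -- the component along `Q` differs from `Q` only to second order
  have hH : Tendsto (fun ε => Qᵀ * F ε + 1) l (𝓝 (1 + 1)) := by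
    have := (tendsto_matrix_mul (tendsto_const_nhds (x := Qᵀ)) hFQ).add_const 1
    rwa [hQ.orthonormal] at this
  have h2 : (1 + 1 : Matrix (Fin m) (Fin m) ℝ) * ((1 / 2 : ℝ) • 1) = 1 := by
    rw [Matrix.mul_smul, Matrix.mul_one, smul_add, ← add_smul]
    norm_num
  have hB : Tendsto (fun ε => P * F ε * (Qᵀ * F ε + 1)⁻¹) l (𝓝 0) := by
    have := tendsto_matrix_mul hZ0 (tendsto_matrix_inv hH h2)
    rwa [Matrix.zero_mul] at this
  have hsecond := isLittleO_mul_mul_entry (f := fun ε => (P * F ε)ᵀ)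
    (L := (Matrix.transposeLinearEquiv (Fin n) (Fin m) ℝ ℝ).toLinearMap ∘ₗ firstOrder x Q lam)
    (fun p q => hZ q p) (tendsto_const_nhds (x := -Q)) hB i j
  refine ((hZ i j).add hsecond).congr' ?_ EventuallyEq.rfl
  filter_upwards [hF, eventually_isUnit_det hH h2] with ε ⟨hε, hpos⟩ hdet
  have hsym : (F ε)ᵀ * Q = Qᵀ * F ε := by
    have := hpos.isHermitian.eq
    rwa [Matrix.conjTranspose_eq_transpose_of_trivial, Matrix.transpose_mul,
      Matrix.transpose_transpose] at this
  have h3 : -((P * F ε)ᵀ * (P * F ε)) = (Qᵀ * F ε - 1) * (Qᵀ * F ε + 1) := by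
    rw [Matrix.transpose_mul, Matrix.mul_assoc, ← Matrix.mul_assoc Pᵀ, hPP, hP, Matrix.sub_mul,
      Matrix.mul_sub, Matrix.one_mul, hε.orthonormal, Matrix.mul_assoc Q, ← Matrix.mul_assoc _ Q,
      hsym]
    noncomm_ring
  have h4 : -Q * (P * F ε)ᵀ * (P * F ε * (Qᵀ * F ε + 1)⁻¹) = Q * (Qᵀ * F ε - 1) := by
    calc -Q * (P * F ε)ᵀ * (P * F ε * (Qᵀ * F ε + 1)⁻¹)
        = Q * (-((P * F ε)ᵀ * (P * F ε)) * (Qᵀ * F ε + 1)⁻¹) := by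
          simp only [Matrix.neg_mul, Matrix.mul_neg, Matrix.mul_assoc]
      _ = Q * (Qᵀ * F ε - 1) := by
          rw [h3, Matrix.mul_nonsing_inv_cancel_right _ _ hdet]
  have h5 : F ε - Q = P * F ε + Q * (Qᵀ * F ε - 1) := by
    rw [hP, Matrix.sub_mul, Matrix.mul_sub, Matrix.one_mul, Matrix.mul_one, Matrix.mul_assoc]
    abel
  rw [h4, h5, Matrix.mul_zero, Matrix.zero_apply, Matrix.add_apply]
  ring

/-- For data spanning an `m`-dimensional space, the top `m` eigenvalues are positive, the top
eigenvectors span the data, and the certificate holds with `c = 0`. -/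
theorem isDominant_of_finrank_eq {n m N : ℕ} (hmn : m ≤ n) {x : Fin N → Vec n}
    (hm : Module.finrank ℝ (Submodule.span ℝ (Set.range x)) = m)
    {Q : Matrix (Fin n) (Fin m) ℝ} {lam : Fin m → ℝ}
    (hQ : IsTopEigenvectors (covMatrix x x) Q lam) :
    (∀ j, 0 < lam j) ∧ dataMatrix x * Q * Qᵀ = dataMatrix x ∧
      IsDominant (covMatrix x x) Q lam 0 := by
  obtain ⟨c, hd⟩ := (isTopEigenvectors_iff hmn (covMatrix_self_transpose x) Q lam).mp hQ
  have hr : m ≤ (dataMatrix x).rank := by rw [← finrank_span_eq_rank, hm]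
  have hlam := hd.pos hr
  have hfeas : IsFeasible x Q := by
    simpa using hd.isFeasible_mul hlam (one_mem (Matrix.orthogonalGroup (Fin m) ℝ))
  let q : Fin m → Vec n := fun j => WithLp.toLp 2 fun i => Q i j
  have hon : Orthonormal ℝ q := by
    rw [orthonormal_iff_ite]
    intro a b
    have := congrFun (congrFun hd.orthonormal a) b
    rw [Matrix.mul_apply, Matrix.one_apply] at this
    rw [← this]
    simp [q, PiLp.inner_apply, mul_comm]
  have hspan : Submodule.span ℝ (Set.range q) = Submodule.span ℝ (Set.range x) := by
    apply Submodule.eq_of_le_of_finrank_eq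
    · rw [Submodule.span_le]
      rintro _ ⟨j, rfl⟩
      exact hfeas.2 j
    · rw [finrank_span_eq_card hon.linearIndependent, hm, Fintype.card_fin]
  have hxq (k : Fin N) : ∃ c : Fin m → ℝ, ∑ j, c j • q j = x k := by
    rw [← Submodule.mem_span_range_iff_exists_fun, hspan]
    exact Submodule.subset_span ⟨k, rfl⟩
  choose b hb using hxq
  have hX : dataMatrix x = Matrix.of b * Qᵀ := by
    ext k i
    have := congrArg (fun v : Vec n => v i) (hb k)
    simpa [dataMatrix, Matrix.mul_apply, q] using this.symm
  have hXQ : dataMatrix x * Q * Qᵀ = dataMatrix x := by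
    rw [hX, Matrix.mul_assoc _ Qᵀ Q, hd.orthonormal, Matrix.mul_one]
  refine ⟨hlam, hXQ, hd.orthonormal, hd.eigen, fun j => (hlam j).le, ?_⟩
  have hzero : (0 : ℝ) • 1 - covMatrix x x +
      Q * Matrix.diagonal (fun j => lam j - 0) * Qᵀ = 0 := by
    simp only [sub_zero, zero_smul, zero_sub]
    rw [← hd.eigen, covMatrix_eq, Matrix.mul_assoc _ Q, Matrix.mul_assoc, ← Matrix.mul_assoc _ Q,
      hXQ, neg_add_cancel]
  rw [hzero]
  exact Matrix.PosSemidef.zero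

theorem eventually_le_rank {n m N : ℕ} {x : Fin N → Vec n}
    {Q : Matrix (Fin n) (Fin m) ℝ} {lam : Fin m → ℝ} {c : ℝ}
    (hQ : IsDominant (covMatrix x x) Q lam c) (hlam : ∀ j, 0 < lam j) :
    ∀ᶠ ε in 𝓝 (0 : Fin N → Vec n), m ≤ (dataMatrix (x + ε)).rank := by
  have h1 : Tendsto (fun ε => Qᵀ * covMatrix (x + ε) (x + ε) * Q) (𝓝 0)
      (𝓝 (Matrix.diagonal lam)) := by
    have := tendsto_matrix_mul (tendsto_matrix_mul (tendsto_const_nhds (x := Qᵀ))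
      (tendsto_covMatrix x le_rfl)) (tendsto_const_nhds (x := Q))
    rwa [Matrix.mul_assoc Qᵀ, hQ.eigen, ← Matrix.mul_assoc, hQ.orthonormal, Matrix.one_mul] at this
  filter_upwards [eventually_isUnit_det h1 (diagonal_mul_inv hlam)] with ε hε
  have h2 := Matrix.rank_of_isUnit _ ((Matrix.isUnit_iff_isUnit_det _).mpr hε)
  rw [Fintype.card_fin, covMatrix_eq, ← Matrix.mul_assoc, Matrix.mul_assoc] at h2
  calc m = _ := h2.symm
    _ ≤ (dataMatrix (x + ε) * Q).rank := Matrix.rank_mul_le_right _ _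
    _ ≤ (dataMatrix (x + ε)).rank := Matrix.rank_mul_le_left _ _

/-! ### Noise orthogonal to the data, sensitivity, and aligned encoders -/

theorem data_mul_eq_zero_of_orthogonal {n m N : ℕ} {x ε : Fin N → Vec n}
    (hε : ∀ k, ε k ∈ (Submodule.span ℝ (Set.range x))ᗮ) {Q : Matrix (Fin n) (Fin m) ℝ}
    (hQ : IsFeasible x Q) : dataMatrix ε * Q = 0 := by
  ext k j
  have h := Submodule.inner_right_of_mem_orthogonal (hQ.2 j) (hε k)
  simpa [PiLp.inner_apply, Matrix.mul_apply, dataMatrix] using h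

/-- Noise orthogonal to the data changes neither the action of the cross-covariance on `Q` nor its
block on the orthogonal complement of `Q`, hence not the characteristic polynomial. -/
theorem isTopEigenvectors_of_orthogonal {n m N : ℕ} (hmn : m ≤ n) {x ε : Fin N → Vec n}
    {Q : Matrix (Fin n) (Fin m) ℝ} {lam : Fin m → ℝ}
    (hQ : IsTopEigenvectors (covMatrix x x) Q lam) (hx : dataMatrix x * Q * Qᵀ = dataMatrix x)
    (hεQ : dataMatrix ε * Q = 0) : IsTopEigenvectors (covMatrix x (x + ε)) Q lam := by
  obtain ⟨hQ1, hCQ, s, hs, hle⟩ := hQ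
  have hcov : covMatrix x (x + ε) = covMatrix x x + (dataMatrix x)ᵀ * dataMatrix ε := by
    rw [covMatrix_eq, covMatrix_eq, show dataMatrix (x + ε) = dataMatrix x + dataMatrix ε from rfl,
      Matrix.mul_add]
  have hCεQ : covMatrix x (x + ε) * Q = Q * Matrix.diagonal lam := by
    rw [hcov, Matrix.add_mul, Matrix.mul_assoc _ (dataMatrix ε), hεQ, Matrix.mul_zero, add_zero,
      hCQ]
  refine ⟨hQ1, hCεQ, s, ?_, hle⟩
  rw [← hs]
  obtain ⟨k, rfl⟩ := Nat.exists_eq_add_of_le hmn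
  obtain ⟨B, -, hQB, hBQ, h1⟩ := splitting_of_orthonormal Q hQ1
  have hXB : Bᵀ * (dataMatrix x)ᵀ = 0 := by
    have : dataMatrix x * B = 0 := by rw [← hx, Matrix.mul_assoc, hQB, Matrix.mul_zero]
    rw [← Matrix.transpose_mul, this, Matrix.transpose_zero]
  rw [charpoly_of_invariant _ hQ1 hBQ h1 hCεQ, charpoly_of_invariant _ hQ1 hBQ h1 hCQ, hcov,
    Matrix.mul_add, ← Matrix.mul_assoc Bᵀ (dataMatrix x)ᵀ, hXB, Matrix.zero_mul, add_zero]

theorem rank_le_of_orthogonal {n m N : ℕ} {x ε : Fin N → Vec n}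
    {Q : Matrix (Fin n) (Fin m) ℝ} (hx : dataMatrix x * Q * Qᵀ = dataMatrix x)
    (hεQ : dataMatrix ε * Q = 0) : (dataMatrix x).rank ≤ (dataMatrix (x + ε)).rank := by
  have h : dataMatrix (x + ε) * Q * Qᵀ = dataMatrix x := by
    rw [show dataMatrix (x + ε) = dataMatrix x + dataMatrix ε from rfl, Matrix.add_mul, hεQ,
      add_zero, hx]
  rw [← h, Matrix.mul_assoc]
  exact Matrix.rank_mul_le_left _ _

theorem exists_sensitivity_ne_zero {n m : ℕ} (hmn : m < n) {Q : Matrix (Fin n) (Fin m) ℝ}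
    (hQ : Qᵀ * Q = 1) {lam : Fin m → ℝ} (hlam : ∀ j, 0 < lam j) {v : Vec n} (hv : v ≠ 0)
    (hvQ : (v : Fin n → ℝ) ᵥ* Q ᵥ* Qᵀ = v) : ∃ i, sensitivity Q lam v i ≠ 0 := by
  by_contra! h
  have hP : 1 - Q * Qᵀ ≠ 0 := by
    intro h0
    have h1 := congrArg Matrix.trace (sub_eq_zero.mp h0)
    rw [Matrix.trace_mul_comm, hQ, Matrix.trace_one, Matrix.trace_one, Fintype.card_fin,
      Fintype.card_fin] at h1
    exact hmn.ne' (by exact_mod_cast h1)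
  have hw : (v : Fin n → ℝ) ᵥ* Q ≠ 0 := by
    intro h0
    rw [h0, Matrix.zero_vecMul] at hvQ
    exact hv (by ext i; exact (congrFun hvQ i).symm)
  obtain ⟨j, hj⟩ := Function.ne_iff.mp hw
  apply hP
  ext a i
  have h1 := congrFun (congrFun (h i) a) j
  rw [sensitivity, Matrix.mul_diagonal, Matrix.mul_vecMulVec, Matrix.vecMulVec_mul,
    Matrix.vecMulVec_apply, Matrix.mulVec_single_one, Matrix.zero_apply] at h1
  have h2 : (lam j)⁻¹ ≠ 0 := inv_ne_zero (hlam j).ne'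
  simpa [h2, show ((v : Fin n → ℝ) ᵥ* Q) j ≠ 0 from hj] using h1

theorem IsOptimalEncoder.isPrincipalFrame {n m N : ℕ} (hmn : m ≤ n) {y : Fin N → Vec n}
    (hr : m ≤ (dataMatrix y).rank) {Q : Matrix (Fin n) (Fin m) ℝ} (h : IsOptimalEncoder y Q) :
    IsPrincipalFrame (covMatrix y y) Q := by
  obtain ⟨A, hA⟩ := h
  obtain ⟨-, U, ν, c, R, hR, hU, rfl⟩ := hA.eq_and_exists hmn hr
  exact hU.isPrincipalFrame.mul hR

theorem IsOptimalEncoder.mul {n m N : ℕ} (hmn : m ≤ n) {y : Fin N → Vec n}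
    (hr : m ≤ (dataMatrix y).rank) {Q : Matrix (Fin n) (Fin m) ℝ} (h : IsOptimalEncoder y Q)
    {R : Matrix (Fin m) (Fin m) ℝ} (hR : R ∈ Matrix.orthogonalGroup (Fin m) ℝ) :
    IsOptimalEncoder y (Q * R) := by
  obtain ⟨A, hA⟩ := h
  obtain ⟨-, U, ν, c, R', hR', hU, rfl⟩ := hA.eq_and_exists hmn hr
  rw [Matrix.mul_assoc]
  exact ⟨_, hU.isOptimal_mul hmn hr (mul_mem hR' hR)⟩

theorem alignment_transpose_mem {n m : ℕ} (V Q : Matrix (Fin n) (Fin m) ℝ) :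
    (alignment V Q)ᵀ ∈ Matrix.orthogonalGroup (Fin m) ℝ :=
  Matrix.transpose_mem_unitaryGroup_iff.mpr (alignment_mem V Q)

theorem eventually_aligned {n m N : ℕ} (hmn : m ≤ n) {x : Fin N → Vec n}
    {Q : Matrix (Fin n) (Fin m) ℝ} {lam : Fin m → ℝ} {c : ℝ}
    (hQ : IsDominant (covMatrix x x) Q lam c) (hlam : ∀ j, 0 < lam j)
    {l : Filter (Fin N → Vec n)} (hl : l ≤ 𝓝 0)
    {V : (Fin N → Vec n) → Matrix (Fin n) (Fin m) ℝ}
    (hV : ∀ᶠ ε in l, IsOptimalEncoder (x + ε) (V ε)) :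
    ∀ᶠ ε in l, IsPrincipalFrame (covMatrix (x + ε) (x + ε)) (V ε * (alignment (V ε) Q)ᵀ) ∧
      (Qᵀ * (V ε * (alignment (V ε) Q)ᵀ)).PosSemidef := by
  filter_upwards [hV, hl (eventually_le_rank hQ hlam)] with ε hε hr
  have hp := hε.isPrincipalFrame hmn hr
  exact ⟨hp.mul (alignment_transpose_mem _ _), posSemidef_aligned hp.orthonormal hQ.orthonormal⟩

theorem eq_of_tendsto_nhdsWithin {E F : Type*} [TopologicalSpace E] [TopologicalSpace F]
    [T1Space F] {S : Set E} {a : E} (ha : a ∈ S) {f : E → F} {b : F}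
    (h : Tendsto f (𝓝[S] a) (𝓝 b)) : f a = b := by
  have h1 : Tendsto f (pure a) (𝓝 b) := h.mono_left (pure_le_nhdsWithin ha)
  rw [tendsto_pure_left] at h1
  by_contra hne
  exact h1 {f a}ᶜ (isOpen_compl_singleton.mem_nhds (Ne.symm hne)) rfl

end LinearAE

theorem proposition2 {n m N : ℕ} (hmn : m < n)
    -- the clean data span the `m`-dimensional space `L`
    (L : Submodule ℝ (LinearAE.Vec n)) (hL : Module.finrank ℝ L = m)
    (x : Fin N → LinearAE.Vec n) (hx : Submodule.span ℝ (Set.range x) = L)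
    -- top-`m` eigenvectors and eigenvalues of the clean covariance matrix
    (Q : Matrix (Fin n) (Fin m) ℝ) (lam : Fin m → ℝ)
    (hQ : LinearAE.IsTopEigenvectors (LinearAE.covMatrix x x) Q lam) :
    -- for noise orthogonal to `L`, they are also those of `C = ∑ₖ xₖ (xₖ + εₖ)ᵀ`,
    -- and the standard autoencoder on the noisy data has an optimal pair
    (∀ ε : Fin N → LinearAE.Vec n, (∀ k, ε k ∈ Lᗮ) →
      LinearAE.IsTopEigenvectors (LinearAE.covMatrix x (x + ε)) Q lam ∧
      ∃ A' Q' : Matrix (Fin n) (Fin m) ℝ, LinearAE.IsOptimal (x + ε) A' Q') ∧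
    -- the optimal pairs are given by the top-`m` eigenvectors of `C'`, up to `O(m)`
    (∀ ε : Fin N → LinearAE.Vec n,
      m ≤ Module.finrank ℝ (Submodule.span ℝ (Set.range (x + ε))) →
      ∀ A' Q' : Matrix (Fin n) (Fin m) ℝ,
        LinearAE.IsOptimal (x + ε) A' Q' ↔
          A' = Q' ∧ ∃ (U : Matrix (Fin n) (Fin m) ℝ) (ν : Fin m → ℝ),
            ∃ R ∈ Matrix.orthogonalGroup (Fin m) ℝ,
              LinearAE.IsTopEigenvectors (LinearAE.covMatrix (x + ε) (x + ε)) U ν ∧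
              Q' = U * R) ∧
    -- there is a choice of optimal encoders that is continuous at zero noise, with value `Q` there
    (∃ Qhat : (Fin N → LinearAE.Vec n) → Matrix (Fin n) (Fin m) ℝ,
      (∀ᶠ ε in 𝓝 0, LinearAE.IsOptimalEncoder (x + ε) (Qhat ε)) ∧
      Qhat 0 = Q ∧ ContinuousAt Qhat 0) ∧
    -- the derivative of the deviation at zero noise
    (∃ G : (Fin N → LinearAE.Vec n) →L[ℝ] Matrix (Fin n) (Fin m) ℝ,
      (∀ k i, G (LinearAE.unitNoise k i) = LinearAE.sensitivity Q lam (x k) i) ∧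
      ∀ S : Set (Fin N → LinearAE.Vec n), 0 ∈ S →
      ∀ Qhat : (Fin N → LinearAE.Vec n) → Matrix (Fin n) (Fin m) ℝ,
      (∀ᶠ ε in 𝓝[S] 0, LinearAE.IsOptimalEncoder (x + ε) (Qhat ε)) →
        -- for the choice that is normalised to `Q` at zero noise
        (Qhat 0 = Q → ContinuousWithinAt Qhat S 0 →
          HasFDerivWithinAt (fun ε => LinearAE.deviation (Qhat ε) Q) G S 0) ∧
        -- for every choice, after rotating the deviation back by the alignment
        HasFDerivWithinAt (fun ε => LinearAE.deviation (Qhat ε) Q *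
          (LinearAE.alignment (Qhat ε) Q)ᵀ) G S 0) ∧
    -- sensitivity to the noise in every nonzero data point
    (∀ k, x k ≠ 0 → ∃ i, LinearAE.sensitivity Q lam (x k) i ≠ 0) := by
  open LinearAE in
  have hm : Module.finrank ℝ (Submodule.span ℝ (Set.range x)) = m := by rw [hx, hL]
  obtain ⟨hlam, hxQ, hdom⟩ := isDominant_of_finrank_eq hmn.le hm hQ
  have hr : m ≤ (dataMatrix x).rank := by rw [← finrank_span_eq_rank, hm]
  refine ⟨fun ε hε => ?_, fun ε hrank A' Q' => ?_, ?_, ?_, fun k hk => ?_⟩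
  · have hfeas : IsFeasible x Q := by
      simpa using hdom.isFeasible_mul hlam (one_mem (Matrix.orthogonalGroup (Fin m) ℝ))
    have hεQ : dataMatrix ε * Q = 0 := data_mul_eq_zero_of_orthogonal (by rwa [hx]) hfeas
    obtain ⟨Q', hQ'⟩ := exists_isOptimal hmn.le (hr.trans (rank_le_of_orthogonal hxQ hεQ))
    exact ⟨isTopEigenvectors_of_orthogonal hmn.le hQ hxQ hεQ, Q', Q', hQ'⟩
  · exact isOptimal_iff hmn.le (by rwa [← finrank_span_eq_rank]) A' Q'
  · classical
    -- rotate an arbitrary optimal encoder into alignment with `Q`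
    let V : (Fin N → Vec n) → Matrix (Fin n) (Fin m) ℝ := fun ε =>
      if h : ∃ Q' : Matrix (Fin n) (Fin m) ℝ, IsOptimalEncoder (x + ε) Q' then h.choose else 0
    have hV : ∀ᶠ ε in 𝓝 0, IsOptimalEncoder (x + ε) (V ε) := by
      filter_upwards [eventually_le_rank hdom hlam] with ε hε
      obtain ⟨Q', hQ'⟩ := exists_isOptimal hmn.le hε
      have h : ∃ Q' : Matrix (Fin n) (Fin m) ℝ, IsOptimalEncoder (x + ε) Q' := ⟨Q', Q', hQ'⟩
      simp only [V, dif_pos h]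
      exact h.choose_spec
    have hlim := tendsto_aligned_principalFrame (tendsto_covMatrix x le_rfl) hdom hlam
      (eventually_aligned hmn.le hdom hlam le_rfl hV)
    have h0 : V 0 * (alignment (V 0) Q)ᵀ = Q :=
      eq_of_tendsto_nhdsWithin (f := fun ε => V ε * (alignment (V ε) Q)ᵀ)
        (Set.mem_univ 0) (by rwa [nhdsWithin_univ])
    refine ⟨fun ε => V ε * (alignment (V ε) Q)ᵀ, ?_, h0, ?_⟩
    · filter_upwards [hV, eventually_le_rank hdom hlam] with ε hε hrε
      exact hε.mul hmn.le hrε (alignment_transpose_mem _ _)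
    · rw [ContinuousAt, h0]
      exact hlim
  · refine ⟨LinearMap.toContinuousLinearMap (firstOrder x Q lam), firstOrder_unitNoise x Q lam,
      fun S hS Qhat hopt => ?_⟩
    have hl : 𝓝[S] (0 : Fin N → Vec n) ≤ 𝓝 0 := nhdsWithin_le_nhds
    have hal := eventually_aligned hmn.le hdom hlam hl hopt
    have hlim := tendsto_aligned_principalFrame (tendsto_covMatrix x hl) hdom hlam hal
    have hlittle := isLittleO_aligned_principalFrame hdom hlam hxQ hl hal
    have h0 : Qhat 0 * (alignment (Qhat 0) Q)ᵀ = Q := eq_of_tendsto_nhdsWithin hS hlim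
    have hRR (ε : Fin N → Vec n) : alignment (Qhat ε) Q * (alignment (Qhat ε) Q)ᵀ = 1 :=
      (Matrix.mem_orthogonalGroup_iff (Fin m) ℝ).mp (alignment_mem _ _)
    have hRR' (ε : Fin N → Vec n) : (alignment (Qhat ε) Q)ᵀ * alignment (Qhat ε) Q = 1 :=
      (Matrix.mem_orthogonalGroup_iff' (Fin m) ℝ).mp (alignment_mem _ _)
    have hrot (ε : Fin N → Vec n) : deviation (Qhat ε) Q * (alignment (Qhat ε) Q)ᵀ =
        Qhat ε * (alignment (Qhat ε) Q)ᵀ - Q := by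
      rw [deviation, Matrix.sub_mul, Matrix.mul_assoc Q, hRR, Matrix.mul_one]
    have hdev (ε : Fin N → Vec n) : deviation (Qhat ε) Q =
        (Qhat ε * (alignment (Qhat ε) Q)ᵀ - Q) * alignment (Qhat ε) Q := by
      rw [← hrot, Matrix.mul_assoc, hRR', Matrix.mul_one]
    constructor
    · intro hQ0 hcont
      -- the alignment is `Fᵀ V` for the aligned encoder `F = V R⋆ᵀ`, and both tend to `Q`
      have hR : Tendsto (fun ε => alignment (Qhat ε) Q) (𝓝[S] 0) (𝓝 1) := by
        have hc : Tendsto Qhat (𝓝[S] 0) (𝓝 Q) := by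
          have h := hcont.tendsto
          rwa [hQ0] at h
        have h1 := tendsto_matrix_mul
          ((continuous_id.matrix_transpose.tendsto Q).comp hlim) hc
        rw [id, hdom.orthonormal] at h1
        refine h1.congr' ?_
        filter_upwards [hopt, hl (eventually_le_rank hdom hlam)] with ε hε hrε
        have h2 := (hε.isPrincipalFrame hmn.le hrε).orthonormal
        simp only [Function.comp_apply, id, Matrix.transpose_mul, Matrix.transpose_transpose]
        rw [Matrix.mul_assoc, h2, Matrix.mul_one]
      refine hasFDerivWithinAt_of_isLittleO_entry ?_ fun i j => ?_
      · rw [hdev, h0, sub_self, Matrix.zero_mul]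
      · have h1 := isLittleO_mul_mul_entry hlittle (tendsto_const_nhds (x := 1)) hR i j
        refine h1.congr_left fun ε => ?_
        rw [hdev, Matrix.one_mul, Matrix.one_mul, Matrix.mul_one]
        rfl
    · refine hasFDerivWithinAt_of_isLittleO_entry ?_ fun i j => ?_
      · rw [hrot, h0, sub_self]
      · refine (hlittle i j).congr_left fun ε => ?_
        rw [hrot]
        rfl
  · refine exists_sensitivity_ne_zero hmn hdom.orthonormal hlam hk ?_
    have h1 := congrFun hxQ k
    rw [Matrix.vecMul_vecMul]
    rw [Matrix.mul_assoc] at h1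
    exact h1
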